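/- For a graph $G$, let $R_3(G)$ denote the smallest integer $n$ such that every colouring of the edges of the complete graph $K_n$ with three colours contains a monochromatic (not necessarily induced) copy of $G$. Let $P_8$ be the path on $8$ vertices. Then $R_3(P_8)=14$. That is, every colouring of the edges of $K_{14}$ with three colours contains a monochromatic path on $8$ vertices, and there is a colouring of the edges of $K_{13}$ with three colours that contains none. -/

import Mathlib

/-- `RamseyArrows n H`: for every colouring of the edges of the complete graph `K_n` on `n`
vertices with the `k` colours `0, …, k - 1`, there is a colour `i` such that the graph formed by
the edges of colour `i` contains a (not necessarily induced) copy of `H i`. -/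
def RamseyArrows (n : ℕ) {k : ℕ} {W : Fin k → Type*} (H : (i : Fin k) → SimpleGraph (W i)) :
    Prop :=
  ∀ C : SimpleGraph.TopEdgeLabeling (Fin n) (Fin k),
    ∃ i : Fin k, (H i).IsContained (C.labelGraph i)

/-- `IsRamseyNumber H n`: the multicolour Ramsey number `R(H_1, …, H_k)` is equal to `n`, that is,
`n` is the smallest number such that every colouring of the edges of `K_n` with `k` colours
contains a copy of `H_i` in colour `i` for some `i`. -/
def IsRamseyNumber {k : ℕ} {W : Fin k → Type*} (H : (i : Fin k) → SimpleGraph (W i)) (n : ℕ) :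
    Prop :=
  IsLeast {m : ℕ | RamseyArrows m H} n

/-- The diagonal case: `R_k(G) = R(G, …, G)`, with `G` repeated `k` times, is equal to `n`. -/
def IsDiagonalRamseyNumber (k : ℕ) {W : Type*} (G : SimpleGraph W) (n : ℕ) : Prop :=
  IsRamseyNumber (fun _ : Fin k => G) n

/-! Upper bound: the degree sums of the three colours on `K_14` add up to at least 182, so some
colour `R` has degree sum at least 61, hence at least 62 by parity. If no edge of `R` joins `A` to
its complement, the other two colours cover that complete bipartite graph. The sizes 7+7
(`P8Free.not_seven_seven`) and 6+8 (`P8Free.not_six_eight`, which also uses the colours inside the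
eight vertices) are impossible, so an `R`-closed set has at most five or at least nine vertices. A
smallest `R`-closed set `Z` with at least nine vertices is then connected and has at least `2|Z| +
3` edges.

The structural core is `P8Free.exists_cover`: three vertices `H` cover all edges of such a set. It
passes to a smallest connected subset `K` that is still this dense. Ends of longest paths in `K`
have degree at least 3, and Pósa's rotations leave a spanning cycle on six or seven vertices, or
longest paths on seven vertices. The cycle is excluded by density and by connectedness of `Z`. For
seven-vertex paths that never close up, the neighbourhoods of the two ends determine each other;
either a `K_4` hangs on one vertex, against minimality, or three hubs cover `K`, and then `Z`.

With the cover, `Z` has at most `3|Z| - 6` edges, which leaves `|Z| = 9` or `|Z| ≥ 12`. In both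
cases `Z \ H` has only the other two colours: `P8Free.not_nine_five` refutes the first, and in the
second deleting `H` from `K_14` leaves at least a two-coloured `K_11` minus an edge
(`P8Free.not_eleven`). The bipartite statements rest on the analysis, in `Quad`, of four vertices
with large neighbourhoods in a small set.

Lower bound: split 13 vertices into classes of sizes 4, 3, 3, 3 indexed by pairs of bits. The
colours are the three ways to pair up the classes, so every monochromatic component has at most
seven vertices. -/

/-! ### Degree sums, cuts and elementary eight-vertex paths. -/

open scoped Classical in
/-- The number of neighbours of `v` inside the finite set `K`. -/
noncomputable def SimpleGraph.degIn {V : Type*} (G : SimpleGraph V) (K : Finset V) (v : V) : ℕ :=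
  (K.filter (G.Adj v)).card

/-- The sum of the degrees of the subgraph induced on `K`, that is, twice its number of edges. -/
noncomputable def SimpleGraph.degSum {V : Type*} (G : SimpleGraph V) (K : Finset V) : ℕ :=
  ∑ v ∈ K, G.degIn K v

/-- The graph has no path on eight vertices. -/
def SimpleGraph.P8Free {V : Type*} (G : SimpleGraph V) : Prop :=
  ∀ l : List V, l.length = 8 → l.Nodup → ¬ l.IsChain G.Adj

/-- No edge leaves `A` inside `K`. -/
def SimpleGraph.ClosedIn {V : Type*} (G : SimpleGraph V) (K A : Finset V) : Prop :=
  ∀ a ∈ A, ∀ b ∈ K, b ∉ A → ¬ G.Adj a b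

/-- The subgraph induced on `K` is connected (or empty), phrased with cuts. -/
def SimpleGraph.ConnOn {V : Type*} (G : SimpleGraph V) (K : Finset V) : Prop :=
  ∀ A ⊆ K, A.Nonempty → A ≠ K → ¬ G.ClosedIn K A

open scoped Classical

namespace SimpleGraph

variable {V : Type*} {G : SimpleGraph V}

lemma degIn_erase {K : Finset V} {v : V} (hv : v ∈ K) (u : V) :
    G.degIn K u = G.degIn (K.erase v) u + if G.Adj v u then 1 else 0 := by
  unfold degIn
  rw [Finset.filter_erase]
  split_ifs with h
  · rw [Finset.card_erase_add_one]
    simp [hv, h.symm]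
  · rw [Finset.erase_eq_of_notMem]; · rfl
    simp [hv, G.adj_comm u v, h]

lemma degIn_erase_self (K : Finset V) (v : V) : G.degIn (K.erase v) v = G.degIn K v := by
  unfold degIn
  rw [Finset.filter_erase, Finset.erase_eq_of_notMem]
  simp

lemma degSum_erase {K : Finset V} {v : V} (hv : v ∈ K) :
    G.degSum K = G.degSum (K.erase v) + 2 * G.degIn K v := by
  unfold degSum
  rw [← Finset.add_sum_erase _ _ hv, Finset.sum_congr rfl fun u _ => degIn_erase (G := G) hv u,
    Finset.sum_add_distrib, ← Finset.sum_filter, Finset.sum_const, smul_eq_mul, mul_one,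
    ← degIn_erase_self K v]
  change _ = _ + 2 * ((K.erase v).filter (G.Adj v)).card
  change ((K.erase v).filter (G.Adj v)).card + _ = _
  ring

lemma even_degSum (K : Finset V) : Even (G.degSum K) := by
  induction K using Finset.strongInduction with
  | H K ih =>
    rcases K.eq_empty_or_nonempty with rfl | ⟨v, hv⟩
    · simp [degSum]
    · rw [degSum_erase hv]
      exact (ih _ (Finset.erase_ssubset hv)).add (even_two_mul _)

lemma degIn_le_card_sub_one {K : Finset V} {v : V} (hv : v ∈ K) : G.degIn K v ≤ K.card - 1 := by
  rw [← degIn_erase_self, ← Finset.card_erase_of_mem hv]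
  exact Finset.card_filter_le _ _

lemma degSum_le (K : Finset V) : G.degSum K ≤ K.card * (K.card - 1) := by
  unfold degSum
  simpa using Finset.sum_le_card_nsmul K _ (K.card - 1) fun v hv => degIn_le_card_sub_one hv

lemma degIn_eq_zero {K : Finset V} {v : V} (h : ∀ u ∈ K, ¬ G.Adj v u) : G.degIn K v = 0 := by
  simpa [degIn, Finset.filter_eq_empty_iff] using h

lemma ClosedIn.compl {K A : Finset V} (h : G.ClosedIn K A) :
    G.ClosedIn K (K \ A) := fun a ha b hb hb' hab =>
  h b (by simpa [hb] using hb') a (Finset.mem_sdiff.1 ha).1 (Finset.mem_sdiff.1 ha).2 hab.symm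

lemma ClosedIn.degIn_eq {K A : Finset V} (hA : A ⊆ K) (h : G.ClosedIn K A) {v : V} (hv : v ∈ A) :
    G.degIn K v = G.degIn A v := by
  unfold degIn
  congr 1
  ext u
  simp only [Finset.mem_filter]
  exact ⟨fun ⟨h1, h2⟩ => ⟨by_contra fun h3 => h v hv u h1 h3 h2, h2⟩, fun ⟨h1, h2⟩ => ⟨hA h1, h2⟩⟩

lemma ClosedIn.degSum_eq {K A : Finset V} (hA : A ⊆ K) (h : G.ClosedIn K A) :
    G.degSum K = G.degSum A + G.degSum (K \ A) := by
  unfold degSum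
  rw [← Finset.sum_sdiff hA, add_comm]
  congr 1
  · exact Finset.sum_congr rfl fun v hv => h.degIn_eq hA hv
  · exact Finset.sum_congr rfl fun v hv => (h.compl).degIn_eq Finset.sdiff_subset hv

/-- A set whose edges are all covered by three vertices has at most `3 |Z| - 6` edges. -/
lemma degSum_le_of_cover {Z H : Finset V} (hH : H ⊆ Z) (hc : H.card = 3)
    (h : ∀ u ∈ Z, ∀ v ∈ Z, G.Adj u v → u ∈ H ∨ v ∈ H) : G.degSum Z + 12 ≤ 6 * Z.card := by
  have h3 : 3 ≤ Z.card := hc ▸ Finset.card_le_card hH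
  unfold degSum
  rw [← Finset.sum_sdiff hH]
  have h1 : ∑ v ∈ Z \ H, G.degIn Z v ≤ (Z \ H).card • 3 := by
    refine Finset.sum_le_card_nsmul _ _ _ fun v hv => ?_
    rw [← hc]
    refine Finset.card_le_card fun u hu => ?_
    have := Finset.mem_filter.1 hu
    have hv' := Finset.mem_sdiff.1 hv
    exact (h v hv'.1 u this.1 this.2).resolve_left hv'.2
  have h2 : ∑ v ∈ H, G.degIn Z v ≤ H.card • (Z.card - 1) :=
    Finset.sum_le_card_nsmul _ _ _ fun v hv => degIn_le_card_sub_one (hH hv)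
  rw [Finset.card_sdiff_of_subset hH, hc, smul_eq_mul] at h1
  rw [hc, smul_eq_mul] at h2
  omega

lemma P8Free.not_path {l : List V} (h : G.P8Free) (h8 : 8 ≤ l.length) (hn : l.Nodup) :
    ¬ l.IsChain G.Adj := fun hc =>
  h (l.take 8) (by simpa using h8) (hn.sublist (List.take_sublist _ _)) (hc.take 8)

lemma P8Free.elim (h : G.P8Free) {a b c d e f g k : V}
    (hc : G.Adj a b ∧ G.Adj b c ∧ G.Adj c d ∧ G.Adj d e ∧ G.Adj e f ∧ G.Adj f g ∧ G.Adj g k)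
    (hn : a ≠ c ∧ a ≠ d ∧ a ≠ e ∧ a ≠ f ∧ a ≠ g ∧ a ≠ k ∧ b ≠ d ∧ b ≠ e ∧ b ≠ f ∧ b ≠ g ∧ b ≠ k ∧
      c ≠ e ∧ c ≠ f ∧ c ≠ g ∧ c ≠ k ∧ d ≠ f ∧ d ≠ g ∧ d ≠ k ∧ e ≠ g ∧ e ≠ k ∧ f ≠ k) : False := by
  obtain ⟨h1, h2, h3, h4, h5, h6, h7⟩ := hc
  have := h1.ne; have := h2.ne; have := h3.ne; have := h4.ne; have := h5.ne; have := h6.ne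
  have := h7.ne
  refine h [a, b, c, d, e, f, g, k] rfl ?_ (by simp [*])
  simp only [List.nodup_cons, List.mem_cons, List.not_mem_nil, or_false, not_or]
  tauto

lemma exists_four {A : Finset V} (h : 4 ≤ A.card) : ∃ a ∈ A, ∃ b ∈ A, ∃ c ∈ A, ∃ d ∈ A,
    a ≠ b ∧ a ≠ c ∧ a ≠ d ∧ b ≠ c ∧ b ≠ d ∧ c ≠ d := by
  obtain ⟨B, hBA, hB⟩ := Finset.exists_subset_card_eq h
  obtain ⟨a, b, c, d, h1, h2, h3, h4, h5, h6, rfl⟩ := Finset.card_eq_four.1 hB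
  simp only [Finset.insert_subset_iff, Finset.singleton_subset_iff] at hBA
  exact ⟨a, hBA.1, b, hBA.2.1, c, hBA.2.2.1, d, hBA.2.2.2, h1, h2, h3, h4, h5, h6⟩

/-- `K_{4,4}` has a Hamiltonian path, alternating between the sides. -/
lemma P8Free.not_complete_bipartite (h : G.P8Free) {A B : Finset V} (hA : 4 ≤ A.card)
    (hB : 4 ≤ B.card) (hAB : Disjoint A B) : ∃ a ∈ A, ∃ b ∈ B, ¬ G.Adj a b := by
  by_contra! hc
  obtain ⟨a, ha, b, hb, c, hc', d, hd, hn⟩ := exists_four hA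
  obtain ⟨a', ha', b', hb', c', hc'', d', hd', hn'⟩ := exists_four hB
  have hd := Finset.disjoint_left.1 hAB
  exact h.elim (a := a) (b := a') (c := b) (d := b') (e := c) (f := c') (g := d) (k := d')
    ⟨hc _ ‹_› _ ‹_›, (hc _ ‹_› _ ‹_›).symm, hc _ ‹_› _ ‹_›, (hc _ ‹_› _ ‹_›).symm, hc _ ‹_› _ ‹_›,
      (hc _ ‹_› _ ‹_›).symm, hc _ ‹_› _ ‹_›⟩ (by grind)

/-- Pick an element of a set outside a smaller one. -/
lemma exists_avoiding {S : Finset V} (l : List V) (h : l.length < S.card) :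
    ∃ x ∈ S, x ∉ l := by
  obtain ⟨x, hx, hx'⟩ := Finset.exists_mem_notMem_of_card_lt_card
    ((List.toFinset_card_le l).trans_lt h)
  exact ⟨x, hx, by simpa using hx'⟩

end SimpleGraph

/-! ### Longest paths, cutting cycles open, and Pósa's closing argument. -/

/-- `l` lists the vertices of a path inside `K`. -/
def SimpleGraph.IsPathIn {V : Type*} (G : SimpleGraph V) (K : Finset V) (l : List V) : Prop :=
  l.Nodup ∧ l.IsChain G.Adj ∧ ∀ x ∈ l, x ∈ K

/-- `l` lists the vertices of a path of maximal length inside `K`. -/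
def SimpleGraph.IsLongestIn {V : Type*} (G : SimpleGraph V) (K : Finset V) (l : List V) : Prop :=
  G.IsPathIn K l ∧ ∀ l', G.IsPathIn K l' → l'.length ≤ l.length

namespace SimpleGraph

variable {V : Type*} {G : SimpleGraph V}

lemma IsPathIn.length_le {K : Finset V} {l : List V} (h : G.IsPathIn K l) : l.length ≤ K.card := by
  rw [← List.toFinset_card_of_nodup h.1]
  exact Finset.card_le_card fun x hx => h.2.2 x (by simpa using hx)

lemma IsPathIn.reverse {K : Finset V} {l : List V} (h : G.IsPathIn K l) :
    G.IsPathIn K l.reverse := by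
  refine ⟨List.nodup_reverse.2 h.1, ?_, by simpa using h.2.2⟩
  rw [List.isChain_reverse]
  simpa only [G.adj_comm] using h.2.1

lemma IsLongestIn.reverse {K : Finset V} {l : List V} (h : G.IsLongestIn K l) :
    G.IsLongestIn K l.reverse := ⟨h.1.reverse, by simpa using h.2⟩

lemma P8Free.length_lt (h : G.P8Free) {K : Finset V} {l : List V} (hl : G.IsPathIn K l) :
    l.length < 8 := by
  by_contra! h8
  exact h.not_path h8 hl.1 hl.2.1

lemma exists_isLongestIn (G : SimpleGraph V) (K : Finset V) : ∃ l, G.IsLongestIn K l := by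
  let P : ℕ → Prop := fun n => ∃ l, G.IsPathIn K l ∧ l.length = n
  have h0 : P 0 := ⟨[], ⟨List.nodup_nil, List.isChain_nil, by simp⟩, rfl⟩
  obtain ⟨l, hl, hl'⟩ := Nat.findGreatest_spec (P := P) (Nat.zero_le K.card) h0
  exact ⟨l, hl, fun l' h' => hl' ▸ Nat.le_findGreatest h'.length_le ⟨l', h', rfl⟩⟩

lemma IsLongestIn.mem_of_adj {K : Finset V} {a : V} {t : List V} (h : G.IsLongestIn K (a :: t))
    {w : V} (hw : w ∈ K) (haw : G.Adj a w) : w ∈ t := by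
  by_contra hwt
  have := h.2 (w :: a :: t) ⟨?_, ?_, ?_⟩
  · simp at this
  · exact List.nodup_cons.2 ⟨by simp [haw.ne', hwt], h.1.1⟩
  · exact List.isChain_cons_cons.2 ⟨haw.symm, h.1.2.1⟩
  · intro x hx
    rcases List.mem_cons.1 hx with rfl | hx
    · exact hw
    · exact h.1.2.2 x hx

/-- Used with `P` as membership in one side of a cut: a path that no cut edge crosses stays on one
side. -/
lemma forall_mem_of_isChain {P : V → Prop} : ∀ {t : List V}, t.IsChain G.Adj →
    (∀ u ∈ t, ∀ v ∈ t, G.Adj u v → (P u ↔ P v)) → ∀ u ∈ t, ∀ v ∈ t, P u → P v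
  | [], _, _ => by simp
  | [x], _, _ => by simp
  | x :: y :: t, hc, h => by
    rw [List.isChain_cons_cons] at hc
    have ih := forall_mem_of_isChain hc.2 fun u hu v hv =>
      h u (List.mem_cons_of_mem _ hu) v (List.mem_cons_of_mem _ hv)
    have hxy := h x (by simp) y (by simp) hc.1
    intro u hu v hv hPu
    have hy : P y := by
      rcases List.mem_cons.1 hu with rfl | hu
      · exact hxy.1 hPu
      · exact ih u hu y (by simp) hPu
    rcases List.mem_cons.1 hv with rfl | hv
    · exact hxy.2 hy
    · exact ih y (by simp) v hv hy

/-- Deleting an end of a longest path keeps a set connected. -/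
lemma ConnOn.erase_end {K : Finset V} (hK : G.ConnOn K) {a : V} {t : List V}
    (h : G.IsLongestIn K (a :: t)) : G.ConnOn (K.erase a) := by
  intro A hA hne hAK hcl
  have haK : a ∈ K := h.1.2.2 a (by simp)
  -- All neighbours of `a` lie on the tail `t`, so a closed part missing `t` would be closed in `K`
  -- too. Both sides of a cut of `K.erase a` thus meet the path `t`, which then crosses the cut.
  have key : ∀ B ⊆ K.erase a, B.Nonempty → G.ClosedIn (K.erase a) B → ∃ x ∈ B, x ∈ t := by
    intro B hB hne hcl
    by_contra! hx
    refine hK B (hB.trans (Finset.erase_subset _ _)) hne ?_ ?_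
    · rintro rfl
      exact Finset.notMem_erase a B (hB haK)
    · intro x hxB y hy hyB hxy
      by_cases hya : y = a
      · subst hya
        exact hx x hxB (h.mem_of_adj (Finset.mem_of_mem_erase (hB hxB)) hxy.symm)
      · exact hcl x hxB y (Finset.mem_erase.2 ⟨hya, hy⟩) hyB hxy
  obtain ⟨x, hxA, hxt⟩ := key A hA hne hcl
  obtain ⟨y, hyA, hyt⟩ := key (K.erase a \ A) Finset.sdiff_subset
    (Finset.sdiff_nonempty.2 fun h' => hAK (hA.antisymm h')) hcl.compl
  have ht : ∀ u ∈ t, u ∈ K.erase a := fun u hu =>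
    Finset.mem_erase.2 ⟨fun hua => (List.nodup_cons.1 h.1.1).1 (hua ▸ hu),
      h.1.2.2 u (List.mem_cons_of_mem _ hu)⟩
  refine (Finset.mem_sdiff.1 hyA).2 (forall_mem_of_isChain (G := G) (P := (· ∈ A))
    (List.IsChain.tail h.1.2.1) (fun u hu v hv huv => ?_) x hxt y hyt hxA)
  exact ⟨fun hu' => by_contra fun hv' => hcl u hu' v (ht v hv) hv' huv,
    fun hv' => by_contra fun hu' => hcl v hv' u (ht u hu) hu' huv.symm⟩

/-- A cycle can be cut open so that it ends at a given vertex. -/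
lemma exists_rotation {a u : V} {t : List V}
    (hc : (a :: t ++ [a]).IsChain G.Adj) (hu : u ∈ a :: t) :
    ∃ q : List V, (q ++ [u]).Perm (a :: t) ∧ (q ++ [u]).IsChain G.Adj := by
  obtain ⟨l₁, l₂, hl⟩ := List.append_of_mem hu
  refine ⟨l₂ ++ l₁, ?_, ?_⟩
  · rw [hl]
    have : l₂ ++ l₁ ++ [u] = l₂ ++ (l₁ ++ [u]) := by simp
    rw [this, show l₁ ++ u :: l₂ = (l₁ ++ [u]) ++ l₂ by simp]
    exact List.perm_append_comm
  · rw [hl] at hc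
    cases l₁ with
    | nil =>
      simp only [List.nil_append, List.cons.injEq, List.append_nil] at hl hc ⊢
      rw [← hl.1] at *
      exact List.IsChain.tail hc
    | cons x l₁ =>
      simp only [List.cons_append, List.cons.injEq] at hl
      obtain ⟨rfl, -⟩ := hl
      have h1 : (l₂ ++ [a]).IsChain G.Adj := by
        have : (a :: l₁ ++ [u]) ++ (l₂ ++ [a]) = a :: l₁ ++ u :: l₂ ++ [a] := by simp
        rw [← this] at hc
        exact hc.right_of_append
      have h2 : (a :: (l₁ ++ [u])).IsChain G.Adj := by
        have : (a :: (l₁ ++ [u])) ++ (l₂ ++ [a]) = a :: l₁ ++ u :: l₂ ++ [a] := by simp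
        rw [← this] at hc
        exact hc.left_of_append
      have : l₂ ++ a :: l₁ ++ [u] = l₂ ++ a :: (l₁ ++ [u]) := by simp
      rw [this]
      exact List.isChain_split.2 ⟨h1, h2⟩

lemma ConnOn.exists_adj {Z : Finset V} (hZ : G.ConnOn Z) {A : Finset V} (hA : A ⊆ Z)
    (hne : A.Nonempty) (hAZ : A ≠ Z) : ∃ u ∈ A, ∃ w ∈ Z, w ∉ A ∧ G.Adj u w := by
  have := hZ A hA hne hAZ
  simp only [ClosedIn] at this
  push Not at this
  exact this

/-- Connectedness gives an edge leaving the cycle; open the cycle so that it ends at the inner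
endpoint of that edge, then append the outer one. -/
lemma ConnOn.exists_longer {K Z : Finset V} (hZ : G.ConnOn Z) (hKZ : K ⊆ Z) {a : V} {t : List V}
    (h : G.IsPathIn K (a :: t)) (hc : (a :: t ++ [a]).IsChain G.Adj)
    (hne : (a :: t).toFinset ≠ Z) : ∃ l, G.IsPathIn Z l ∧ l.length = (a :: t).length + 1 := by
  obtain ⟨u, hu, w, hw, hwc, huw⟩ := hZ.exists_adj (A := (a :: t).toFinset)
    (fun x hx => hKZ (h.2.2 x (by simpa using hx))) ⟨a, by simp⟩ hne
  rw [List.mem_toFinset] at hu hwc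
  obtain ⟨q, hq, hq'⟩ := exists_rotation hc hu
  refine ⟨q ++ [u] ++ [w], ⟨?_, ?_, ?_⟩, by rw [List.length_append, hq.length_eq]; rfl⟩
  · refine List.nodup_append.2 ⟨hq.nodup_iff.2 h.1, by simp, ?_⟩
    intro x hx y hy
    rw [List.mem_singleton.1 hy]
    rintro rfl
    exact hwc (hq.mem_iff.1 hx)
  · refine List.isChain_append.2 ⟨hq', by simp, ?_⟩
    simpa using huw
  · intro x hx
    rcases List.mem_append.1 hx with hx | hx
    · exact hKZ (h.2.2 x (hq.mem_iff.1 hx))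
    · rw [List.mem_singleton.1 hx]; exact hw

lemma degIn_le_length {K : Finset V} {v : V} (l : List V) (h : ∀ w ∈ K, G.Adj v w → w ∈ l) :
    G.degIn K v ≤ l.length := by
  refine le_trans (Finset.card_le_card fun w hw => ?_) (List.toFinset_card_le l)
  rw [Finset.mem_filter] at hw
  simpa using h w hw.1 hw.2

lemma degIn_le_countP {K : Finset V} {v : V} (l : List V) (h : ∀ w ∈ K, G.Adj v w → w ∈ l) :
    G.degIn K v ≤ l.countP (G.Adj v ·) := by
  rw [List.countP_eq_length_filter]
  exact degIn_le_length _ fun w hw hvw => by simp [h w hw hvw, hvw]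

/-- The counting step in Pósa's argument. -/
lemma exists_crossing_or (a z : V) : ∀ (x : V) (t : List V),
    (∃ l₁ u v l₂, x :: t = l₁ ++ u :: v :: l₂ ∧ G.Adj z u ∧ G.Adj a v) ∨
      (x :: t).dropLast.countP (G.Adj z ·) + t.countP (G.Adj a ·) ≤ t.length
  | x, [] => by simp
  | x, y :: t => by
    rcases exists_crossing_or a z y t with ⟨l₁, u, v, l₂, h, hz, ha⟩ | h
    · exact .inl ⟨x :: l₁, u, v, l₂, by simp [h], hz, ha⟩
    · by_cases hx : G.Adj z x ∧ G.Adj a y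
      · exact .inl ⟨[], x, y, t, by simp, hx.1, hx.2⟩
      · right
        rw [List.dropLast_cons_cons, List.countP_cons, List.countP_cons (a := y)]
        have : (if decide (G.Adj z x) = true then 1 else 0) +
          (if decide (G.Adj a y) = true then 1 else 0) ≤ 1 := by
          by_cases h1 : G.Adj z x <;> by_cases h2 : G.Adj a y <;> simp_all
        simp only [List.length_cons]
        omega

/-- Reversing the segment after `u` uses the chord `zu` and makes `v` the last vertex; the chord
`av` closes the cycle. -/
lemma exists_closed_of_crossing {K : Finset V} {a z : V} {t l₁ l₂ : List V} {u v : V}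
    (h : G.IsPathIn K (a :: t)) (hz : (a :: t).getLast? = some z) (hl : a :: t = l₁ ++ u :: v :: l₂)
    (hzu : G.Adj z u) (hav : G.Adj a v) :
    ∃ t', t'.length = t.length ∧ G.IsPathIn K (a :: t') ∧ (a :: t' ++ [a]).IsChain G.Adj := by
  have hperm : (l₁ ++ u :: (v :: l₂).reverse).Perm (a :: t) := by
    rw [hl]
    exact List.Perm.append_left _ (List.Perm.cons _ (List.reverse_perm _))
  have hch : (l₁ ++ u :: (v :: l₂).reverse).IsChain G.Adj := by
    have h2 := h.2.1
    rw [hl, List.isChain_append_cons_cons] at h2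
    have hz' : (v :: l₂).getLast? = some z := by
      rw [← hz, hl, List.getLast?_append, List.getLast?_cons_cons]
      simp [List.getLast?_cons]
    have h3 : ((v :: l₂).reverse).IsChain G.Adj := by
      rw [List.isChain_reverse]; simpa only [G.adj_comm] using h2.2.2
    have : l₁ ++ u :: (v :: l₂).reverse = (l₁ ++ [u]) ++ (v :: l₂).reverse := by simp
    rw [this, List.isChain_append]
    refine ⟨h2.1, h3, ?_⟩
    rw [List.head?_reverse, hz']
    simpa using hzu.symm
  obtain ⟨t', ht'⟩ : ∃ t', l₁ ++ u :: (v :: l₂).reverse = a :: t' := by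
    cases l₁ with
    | nil => simp only [List.nil_append, List.cons.injEq] at hl; exact ⟨_, by rw [hl.1]; rfl⟩
    | cons x l₁ => simp only [List.cons_append, List.cons.injEq] at hl; exact ⟨_, by rw [hl.1]; rfl⟩
  refine ⟨t', ?_, ?_, ?_⟩
  · rw [ht'] at hperm; simpa using hperm.length_eq
  · rw [ht'] at hperm hch
    exact ⟨hperm.nodup_iff.2 h.1, hch, fun x hx => h.2.2 x (hperm.mem_iff.1 hx)⟩
  · rw [← ht', List.isChain_append]
    refine ⟨hch, by simp, ?_⟩
    simp [List.getLast?_append, List.getLast?_cons, hav.symm]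

lemma P8Free.not_closed7 (hG : G.P8Free) {K Z : Finset V} (hZ : G.ConnOn Z) (hKZ : K ⊆ Z)
    (h8 : 8 ≤ Z.card) {a : V} {t : List V} (h : G.IsPathIn K (a :: t)) (ht : t.length = 6)
    (hc : (a :: t ++ [a]).IsChain G.Adj) : False := by
  obtain ⟨l, hl, hl'⟩ := hZ.exists_longer hKZ h hc (by
    rintro rfl
    have := List.toFinset_card_le (a :: t)
    rw [List.length_cons] at this; omega)
  have := hG.length_lt hl
  simp at hl'; omega

end SimpleGraph

/-! ### Seven-vertex paths that do not close up, and the neighbourhoods of their ends. -/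

/-- `a b c d e f g` is a path on seven vertices in `K`. -/
def SimpleGraph.IsP7In {V : Type*} (G : SimpleGraph V) (K : Finset V) (a b c d e f g : V) : Prop :=
  (G.Adj a b ∧ G.Adj b c ∧ G.Adj c d ∧ G.Adj d e ∧ G.Adj e f ∧ G.Adj f g) ∧
  (a ≠ b ∧ a ≠ c ∧ a ≠ d ∧ a ≠ e ∧ a ≠ f ∧ a ≠ g ∧ b ≠ c ∧ b ≠ d ∧ b ≠ e ∧ b ≠ f ∧ b ≠ g ∧
    c ≠ d ∧ c ≠ e ∧ c ≠ f ∧ c ≠ g ∧ d ≠ e ∧ d ≠ f ∧ d ≠ g ∧ e ≠ f ∧ e ≠ g ∧ f ≠ g) ∧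
  (a ∈ K ∧ b ∈ K ∧ c ∈ K ∧ d ∈ K ∧ e ∈ K ∧ f ∈ K ∧ g ∈ K)

namespace SimpleGraph

variable {V : Type*} {G : SimpleGraph V}

/-- Pósa's rotation argument: a longest path whose ends have degree at least `3` closes up to
a cycle or has at least seven vertices. -/
lemma IsLongestIn.exists_closed_or {K : Finset V} {a z : V} {t : List V}
    (h : G.IsLongestIn K (a :: t)) (hz : (a :: t).getLast? = some z) (ha3 : 3 ≤ G.degIn K a)
    (hz3 : 3 ≤ G.degIn K z) :
    (∃ t', t'.length = t.length ∧ G.IsPathIn K (a :: t') ∧ (a :: t' ++ [a]).IsChain G.Adj) ∨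
      6 ≤ t.length := by
  rcases exists_crossing_or (G := G) a z a t with ⟨l₁, u, v, l₂, hl, hzu, hav⟩ | hcount
  · exact .inl (exists_closed_of_crossing h.1 hz hl hzu hav)
  · right
    have h1 := degIn_le_countP t fun w hw haw => h.mem_of_adj hw haw
    have h2 : G.degIn K z ≤ ((a :: t).dropLast).countP (G.Adj z ·) := by
      refine degIn_le_countP _ fun w hw hzw => ?_
      obtain ⟨s, hs⟩ := List.getLast?_eq_some_iff.1 hz
      have hr := h.reverse
      rw [hs, List.reverse_append, List.reverse_singleton, List.singleton_append] at hr
      have := hr.mem_of_adj hw hzw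
      rw [hs, List.dropLast_concat]
      simpa using this
    omega

lemma IsP7In.isPathIn {K : Finset V} {a b c d e f g : V} (h : G.IsP7In K a b c d e f g) :
    G.IsPathIn K [a, b, c, d, e, f, g] := by
  obtain ⟨h1, h2, h3⟩ := h
  refine ⟨?_, by simp [h1], by simp [h3]⟩
  simp only [List.nodup_cons, List.mem_cons, List.not_mem_nil, or_false, not_or]
  tauto

lemma IsPathIn.isP7In {K : Finset V} {a b c d e f g : V}
    (h : G.IsPathIn K [a, b, c, d, e, f, g]) : G.IsP7In K a b c d e f g := by
  obtain ⟨h1, h2, h3⟩ := h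
  refine ⟨by simpa using h2, ?_, by simpa using h3⟩
  simp only [List.nodup_cons, List.mem_cons, List.not_mem_nil, or_false, not_or] at h1
  tauto

lemma IsP7In.rev {K : Finset V} {a b c d e f g : V} (h : G.IsP7In K a b c d e f g) :
    G.IsP7In K g f e d c b a := h.isPathIn.reverse.isP7In

lemma IsPathIn.flip {K : Finset V} {a x : V} {p s : List V} (h : G.IsPathIn K (a :: p ++ x :: s))
    (hax : G.Adj a x) : G.IsPathIn K ((a :: p).reverse ++ x :: s) := by
  have hperm : ((a :: p).reverse ++ x :: s).Perm (a :: p ++ x :: s) :=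
    (List.reverse_perm _).append_right _
  refine ⟨hperm.nodup_iff.2 h.1, ?_, fun y hy => h.2.2 y (hperm.mem_iff.1 hy)⟩
  have h2 := List.isChain_append.1 h.2.1
  refine List.isChain_append.2 ⟨?_, h2.2.1, by simpa using hax⟩
  rw [List.isChain_reverse]
  simpa only [G.adj_comm] using h2.1

section flip

variable {K : Finset V} {a b c d e f g : V}

lemma IsP7In.flip2 (h : G.IsP7In K a b c d e f g) (hac : G.Adj a c) : G.IsP7In K b a c d e f g :=
  (h.isPathIn.flip (p := [b]) (s := [d, e, f, g]) hac).isP7In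

lemma IsP7In.flip3 (h : G.IsP7In K a b c d e f g) (had : G.Adj a d) : G.IsP7In K c b a d e f g :=
  (h.isPathIn.flip (p := [b, c]) (s := [e, f, g]) had).isP7In

lemma IsP7In.flip4 (h : G.IsP7In K a b c d e f g) (hae : G.Adj a e) : G.IsP7In K d c b a e f g :=
  (h.isPathIn.flip (p := [b, c, d]) (s := [f, g]) hae).isP7In

lemma IsP7In.flip5 (h : G.IsP7In K a b c d e f g) (haf : G.Adj a f) : G.IsP7In K e d c b a f g :=
  (h.isPathIn.flip (p := [b, c, d, e]) (s := [g]) haf).isP7In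

end flip

/-- Neighbourhood patterns of the ends of a path on seven vertices. -/
structure EndPattern (G : SimpleGraph V) (K : Finset V) (a b c d e f g : V) : Prop where
  path : G.IsP7In K a b c d e f g
  mem : ∀ w ∈ K, G.Adj a w → w = b ∨ w = c ∨ w = d ∨ w = e ∨ w = f
  hc : G.Adj a c ↔ ¬ G.Adj g b
  hd : G.Adj a d ↔ ¬ G.Adj g c
  he : G.Adj a e ↔ ¬ G.Adj g d
  hf : G.Adj a f ↔ ¬ G.Adj g e
  hg : ¬ G.Adj a g
  two : (G.Adj a c ∧ G.Adj a d ∧ ¬ G.Adj a e ∧ ¬ G.Adj a f) ∨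
    (G.Adj a c ∧ ¬ G.Adj a d ∧ G.Adj a e ∧ ¬ G.Adj a f) ∨
    (G.Adj a c ∧ ¬ G.Adj a d ∧ ¬ G.Adj a e ∧ G.Adj a f) ∨
    (¬ G.Adj a c ∧ G.Adj a d ∧ G.Adj a e ∧ ¬ G.Adj a f) ∨
    (¬ G.Adj a c ∧ G.Adj a d ∧ ¬ G.Adj a e ∧ G.Adj a f) ∨
    (¬ G.Adj a c ∧ ¬ G.Adj a d ∧ G.Adj a e ∧ G.Adj a f)

/-- `K` has no closed seven-vertex path, all seven-vertex paths are longest, and their ends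
have degree at least three. -/
structure Tight (G : SimpleGraph V) (K : Finset V) : Prop where
  longest : ∀ a b c d e f g, G.IsP7In K a b c d e f g → G.IsLongestIn K [a, b, c, d, e, f, g]
  three_le : ∀ a b c d e f g, G.IsP7In K a b c d e f g → 3 ≤ G.degIn K a
  not_closed : ∀ a b c d e f g, G.IsP7In K a b c d e f g → ¬ G.Adj g a

lemma endPattern_aux {c d e f b' c' d' e' : Prop}
    (h1 : 3 ≤ (if c then 1 else 0) + (if d then 1 else 0) + (if e then 1 else 0) +
      (if f then 1 else 0) + 1)
    (h2 : 3 ≤ (if b' then 1 else 0) + (if c' then 1 else 0) + (if d' then 1 else 0) +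
      (if e' then 1 else 0) + 1)
    (hc : ¬ (c ∧ b')) (hd : ¬ (d ∧ c')) (he : ¬ (e ∧ d')) (hf : ¬ (f ∧ e')) :
    (c ↔ ¬ b') ∧ (d ↔ ¬ c') ∧ (e ↔ ¬ d') ∧ (f ↔ ¬ e') ∧
    ((c ∧ d ∧ ¬ e ∧ ¬ f) ∨ (c ∧ ¬ d ∧ e ∧ ¬ f) ∨ (c ∧ ¬ d ∧ ¬ e ∧ f) ∨
    (¬ c ∧ d ∧ e ∧ ¬ f) ∨ (¬ c ∧ d ∧ ¬ e ∧ f) ∨ (¬ c ∧ ¬ d ∧ e ∧ f)) := by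
  by_cases c <;> by_cases d <;> by_cases e <;> by_cases f <;> simp_all <;>
    split_ifs at h2 <;> simp_all

lemma Tight.endPattern {K : Finset V} (hK : G.Tight K) {a b c d e f g : V}
    (h : G.IsP7In K a b c d e f g) : EndPattern G K a b c d e f g := by
  have hga := hK.not_closed _ _ _ _ _ _ _ h
  have hag : ¬ G.Adj a g := fun h' => hga h'.symm
  have ha := hK.three_le _ _ _ _ _ _ _ h
  have hg := hK.three_le _ _ _ _ _ _ _ h.rev
  have ha' := fun w => (hK.longest _ _ _ _ _ _ _ h).mem_of_adj (w := w)
  have hg' := fun w => (hK.longest _ _ _ _ _ _ _ h.rev).mem_of_adj (w := w)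
  have h1 := ha.trans (degIn_le_countP _ ha')
  have h2 := hg.trans (degIn_le_countP _ hg')
  have hP := h
  obtain ⟨⟨e1, e2, e3, e4, e5, e6⟩, hne, hm⟩ := h
  -- A crossing pair of chords: rotating at `g` along one of them brings a neighbour of `a` to the
  -- end, and the other chord closes a seven-cycle. The same holds for the next three pairs.
  have hc : ¬ (G.Adj a c ∧ G.Adj g b) := fun h' => hK.not_closed _ _ _ _ _ _ _ (hP.rev.flip5 h'.2) h'.1
  have hd : ¬ (G.Adj a d ∧ G.Adj g c) := fun h' => hK.not_closed _ _ _ _ _ _ _ (hP.rev.flip4 h'.2) h'.1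
  have he : ¬ (G.Adj a e ∧ G.Adj g d) := fun h' => hK.not_closed _ _ _ _ _ _ _ (hP.rev.flip3 h'.2) h'.1
  have hf : ¬ (G.Adj a f ∧ G.Adj g e) := fun h' => hK.not_closed _ _ _ _ _ _ _ (hP.rev.flip2 h'.2) h'.1
  have h1' : 3 ≤ (if G.Adj a c then 1 else 0) + (if G.Adj a d then 1 else 0) +
      (if G.Adj a e then 1 else 0) + (if G.Adj a f then 1 else 0) + 1 := by
    simp only [List.countP_cons, List.countP_nil, decide_eq_true_eq, e1, hag,
      if_true, if_false, zero_add] at h1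
    omega
  have h2' : 3 ≤ (if G.Adj g b then 1 else 0) + (if G.Adj g c then 1 else 0) +
      (if G.Adj g d then 1 else 0) + (if G.Adj g e then 1 else 0) + 1 := by
    simp only [List.countP_cons, List.countP_nil, decide_eq_true_eq, e6.symm, hga,
      if_true, if_false, zero_add] at h2
    omega
  obtain ⟨p1, p2, p3, p4, p5⟩ := endPattern_aux (c := G.Adj a c) (d := G.Adj a d) (e := G.Adj a e)
    (f := G.Adj a f) (b' := G.Adj g b) (c' := G.Adj g c) (d' := G.Adj g d) (e' := G.Adj g e)
    h1' h2' hc hd he hf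
  refine ⟨hP, fun w hw haw => ?_, p1, p2, p3, p4, hag, p5⟩
  have := ha' w hw haw
  simp only [List.mem_cons, List.not_mem_nil, or_false] at this
  rcases this with h | h | h | h | h | rfl
  exacts [.inl h, .inr (.inl h), .inr (.inr (.inl h)), .inr (.inr (.inr (.inl h))),
    .inr (.inr (.inr (.inr h))), (hag haw).elim]

/-- Only two patterns survive: two copies of `K_4` sharing a vertex, and three hubs. -/
lemma Tight.pattern_cases {K : Finset V} (hK : G.Tight K) {a b c d e f g : V}
    (h : G.IsP7In K a b c d e f g) :
    (G.Adj a c ∧ G.Adj a d ∧ ¬ G.Adj a e ∧ ¬ G.Adj a f) ∨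
    (¬ G.Adj a c ∧ G.Adj a d ∧ ¬ G.Adj a e ∧ G.Adj a f) := by
  have hp := hK.endPattern h
  rcases hp.two with h1 | h1 | h1 | h1 | h1 | h1
  · exact .inl h1
  -- In each excluded pattern, a chord that is present rotates the path or its reverse. The end
  -- pattern of the rotated path gives a second relation between the same chords, incompatible with
  -- the original one.
  · have := (hK.endPattern (h.flip4 h1.2.2.1)).hd
    have := hp.hc
    rw [G.adj_comm d a] at *
    tauto
  · have := (hK.endPattern (h.flip5 h1.2.2.2)).he
    have := hp.hc
    rw [G.adj_comm e a] at *
    tauto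
  · have := (hK.endPattern (h.rev.flip5 (by_contra fun h2 => h1.1 (hp.hc.2 h2)))).he
    have := hp.hd
    rw [G.adj_comm c g] at *
    tauto
  · exact .inr h1
  · have := (hK.endPattern (h.flip5 h1.2.2.2)).he
    have := hp.hc
    rw [G.adj_comm e a] at *
    tauto

end SimpleGraph

/-! ### Minimal dense connected sets. -/

namespace SimpleGraph

variable {V : Type*} {G : SimpleGraph V}

/-- Minimal connected sets in which the number of edges exceeds twice the number of vertices
by at least `3`. -/
structure IsDenseMin (G : SimpleGraph V) (K : Finset V) : Prop where
  conn : G.ConnOn K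
  dense : 4 * K.card + 6 ≤ G.degSum K
  min : ∀ K' ⊆ K, G.ConnOn K' → 4 * K'.card + 6 ≤ G.degSum K' → K.card ≤ K'.card

lemma exists_isDenseMin {Z : Finset V} (hZ : G.ConnOn Z) (hD : 4 * Z.card + 6 ≤ G.degSum Z) :
    ∃ K ⊆ Z, IsDenseMin G K := by
  obtain ⟨K, hK, hmin⟩ := Finset.exists_min_image
    (Z.powerset.filter fun K => G.ConnOn K ∧ 4 * K.card + 6 ≤ G.degSum K) Finset.card
    ⟨Z, by simp [hZ, hD]⟩
  simp only [Finset.mem_filter, Finset.mem_powerset] at hK hmin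
  exact ⟨K, hK.1, hK.2.1, hK.2.2, fun K' h1 h2 h3 => hmin K' ⟨h1.trans hK.1, h2, h3⟩⟩

lemma IsDenseMin.six_le {K : Finset V} (hK : IsDenseMin G K) : 6 ≤ K.card := by
  have h1 := hK.dense.trans (degSum_le K)
  by_contra! h
  interval_cases K.card <;> omega

/-- Deleting an end of degree at most 2 costs at most two edges, just what the threshold drops by,
and keeps the set connected; this would contradict minimality. -/
lemma IsDenseMin.three_le {K : Finset V} (hK : IsDenseMin G K) {a : V} {t : List V}
    (h : G.IsLongestIn K (a :: t)) : 3 ≤ G.degIn K a := by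
  by_contra! h3
  have haK : a ∈ K := h.1.2.2 a (by simp)
  have h1 := hK.min _ (Finset.erase_subset a K) (hK.conn.erase_end h) (by
    have := degSum_erase (G := G) haK
    have := hK.dense
    have := Finset.card_erase_add_one haK
    omega)
  have := Finset.card_erase_lt_of_mem haK
  omega

/-- A dense minimal set is either spanned by a cycle on at most seven vertices, or its longest
paths have seven vertices. -/
lemma IsDenseMin.closed_or_seven (hG : G.P8Free) {K : Finset V} (hK : IsDenseMin G K) :
    (∃ a t, G.IsPathIn K (a :: t) ∧ (a :: t ++ [a]).IsChain G.Adj ∧ (a :: t).toFinset = K) ∨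
      ∃ l, G.IsLongestIn K l ∧ l.length = 7 := by
  obtain ⟨l, hl⟩ := exists_isLongestIn G K
  have hK6 := hK.six_le
  cases l with
  | nil =>
    exfalso
    obtain ⟨x, hx⟩ : K.Nonempty := Finset.card_pos.1 (by omega)
    have := hl.2 [x] ⟨by simp, by simp, by simpa using hx⟩
    simp at this
  | cons a t =>
    obtain ⟨s, z, hsz⟩ : ∃ s z, a :: t = s ++ [z] :=
      ⟨(a :: t).dropLast, (a :: t).getLast (by simp), (List.dropLast_append_getLast _).symm⟩
    have hz3 : 3 ≤ G.degIn K z := by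
      have hr := hl.reverse
      rw [hsz, List.reverse_append, List.reverse_singleton, List.singleton_append] at hr
      exact hK.three_le hr
    rcases hl.exists_closed_or (List.getLast?_eq_some_iff.2 ⟨s, hsz⟩) (hK.three_le hl) hz3 with
      ⟨t', ht', hp, hc⟩ | h6
    · left
      refine ⟨a, t', hp, hc, ?_⟩
      by_contra hne
      obtain ⟨l', hl', hlen⟩ := hK.conn.exists_longer subset_rfl hp hc hne
      have := hl.2 l' hl'
      simp only [List.length_cons] at this hlen
      omega
    · right
      refine ⟨_, hl, ?_⟩
      have := hG.length_lt hl.1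
      simp only [List.length_cons] at *
      omega

lemma degSum_le_of_pendant {K : Finset V} : ∀ n (Z : Finset V), K ⊆ Z → Z.card = K.card + n →
    (∀ w ∈ Z, w ∉ K → G.degIn Z w ≤ 1) → G.degSum Z ≤ G.degSum K + 2 * n
  | 0, Z, hKZ, hc, _ => by rw [Finset.eq_of_subset_of_card_le hKZ (by omega)]; omega
  | n + 1, Z, hKZ, hc, h => by
    obtain ⟨w, hw, hwK⟩ := Finset.exists_mem_notMem_of_card_lt_card (by omega : K.card < Z.card)
    have := degSum_le_of_pendant (K := K) n (Z.erase w) (Finset.subset_erase.2 ⟨hKZ, hwK⟩)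
      (by have := Finset.card_erase_add_one hw; omega)
      fun x hx hxK => (Finset.card_le_card (Finset.filter_subset_filter _
        (Finset.erase_subset w Z))).trans (h x (Finset.mem_of_mem_erase hx) hxK)
    have := degSum_erase (G := G) hw
    have := h w hw hwK
    omega

lemma adj_of_degSum_eq {K : Finset V} (h : K.card * (K.card - 1) ≤ G.degSum K) {u v : V}
    (hu : u ∈ K) (hv : v ∈ K) (huv : u ≠ v) : G.Adj u v := by
  have h1 : ∀ x ∈ K, G.degIn K x = K.card - 1 := by
    by_contra! hx
    obtain ⟨x, hx, hne⟩ := hx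
    have : G.degSum K < ∑ x ∈ K, (K.card - 1) :=
      Finset.sum_lt_sum (fun y hy => degIn_le_card_sub_one hy)
        ⟨x, hx, lt_of_le_of_ne (degIn_le_card_sub_one hx) hne⟩
    simp at this
    omega
  have h2 : (K.erase u).filter (G.Adj u) = K.erase u := by
    refine Finset.eq_of_subset_of_card_le (Finset.filter_subset _ _) ?_
    rw [Finset.card_erase_of_mem hu, ← h1 u hu, ← degIn_erase_self]
    rfl
  have : v ∈ (K.erase u).filter (G.Adj u) := by rw [h2]; simp [hv, huv.symm]
  exact (Finset.mem_filter.1 this).2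

/-- In a connected set, a property that holds somewhere and spreads along edges holds
everywhere. -/
lemma ConnOn.forall_mem {K : Finset V} (hK : G.ConnOn K) (P : V → Prop) {a : V} (ha : a ∈ K)
    (hPa : P a) (h : ∀ u ∈ K, P u → ∀ v ∈ K, G.Adj u v → P v) : ∀ v ∈ K, P v := by
  by_contra! hv
  obtain ⟨v, hv, hPv⟩ := hv
  refine hK (K.filter P) (Finset.filter_subset _ _) ⟨a, by simp [ha, hPa]⟩ ?_ ?_
  · intro h'
    rw [← h'] at hv
    exact hPv (Finset.mem_filter.1 hv).2
  · intro u hu w hw hwK huw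
    rw [Finset.mem_filter] at hu hwK
    exact hwK ⟨hw, h u hu.1 hu.2 w hw huw⟩

/-- A seven-cycle extends to a path on eight vertices since `Z` is connected and larger. A six-cycle
forces `K = K_6`, to which the rest of `Z` can only be attached by pendant edges, too few for the
density of `Z`. -/
lemma IsDenseMin.not_spanning_cycle (hG : G.P8Free) {K Z : Finset V} (hK : IsDenseMin G K)
    (hKZ : K ⊆ Z) (hZ : G.ConnOn Z) (h8 : 8 ≤ Z.card) (hD : 4 * Z.card + 6 ≤ G.degSum Z)
    {a : V} {t : List V} (hp : G.IsPathIn K (a :: t)) (hc : (a :: t ++ [a]).IsChain G.Adj)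
    (hs : (a :: t).toFinset = K) : False := by
  have hcard : K.card = (a :: t).length := by rw [← hs, List.toFinset_card_of_nodup hp.1]
  have h7 := hG.length_lt hp
  have hK6 := hK.six_le
  by_cases ht : t.length = 6
  · exact hG.not_closed7 hZ hKZ h8 hp ht hc
  have hK6' : K.card = 6 := by simp only [List.length_cons] at *; omega
  -- On six vertices the density threshold `4 * 6 + 6` equals the maximal degree sum `6 * 5`.
  have hcomp : ∀ u ∈ K, ∀ v ∈ K, u ≠ v → G.Adj u v := fun u hu v hv huv =>
    adj_of_degSum_eq (by rw [hK6']; have := hK.dense; omega) hu hv huv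
  -- A second neighbour of `w` inside `K` yields a seven-cycle; one outside `K` prolongs a
  -- Hamiltonian path of `K` ending at `u` by two vertices.
  have hone : ∀ w ∈ Z, w ∉ K → ∀ u ∈ K, G.Adj u w → ∀ v ∈ Z, G.Adj w v → v = u := by
    intro w hw hwK u hu huw v hv hwv
    by_contra hvu
    by_cases hvK : v ∈ K
    · obtain ⟨p, hp, q, hq, r, hr, s, hs, hne⟩ := exists_four (A := (K.erase u).erase v) (by
        rw [Finset.card_erase_of_mem (by simp [hvK, hvu]), Finset.card_erase_of_mem hu, hK6'])
      simp only [Finset.mem_erase] at hp hq hr hs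
      refine hG.not_closed7 (K := Z) hZ subset_rfl h8 (a := w) (t := [u, p, q, r, s, v])
        ⟨?_, ?_, ?_⟩ rfl ?_
      · simp only [List.nodup_cons, List.mem_cons, List.not_mem_nil, or_false, not_or]
        grind
      · simp only [List.isChain_cons_cons, List.IsChain.singleton, and_true]
        exact ⟨huw.symm, hcomp _ hu _ hp.2.2 (Ne.symm hp.2.1), hcomp _ hp.2.2 _ hq.2.2 hne.1,
          hcomp _ hq.2.2 _ hr.2.2 hne.2.2.2.1, hcomp _ hr.2.2 _ hs.2.2 hne.2.2.2.2.2,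
          hcomp _ hs.2.2 _ hvK hs.1⟩
      · simp only [List.mem_cons, List.not_mem_nil, or_false]
        rintro x (rfl | rfl | rfl | rfl | rfl | rfl | rfl)
        exacts [hw, hKZ hu, hKZ hp.2.2, hKZ hq.2.2, hKZ hr.2.2, hKZ hs.2.2, hKZ hvK]
      · simp only [List.cons_append, List.nil_append, List.isChain_cons_cons,
          List.IsChain.singleton, and_true]
        exact ⟨huw.symm, hcomp _ hu _ hp.2.2 (Ne.symm hp.2.1), hcomp _ hp.2.2 _ hq.2.2 hne.1,
          hcomp _ hq.2.2 _ hr.2.2 hne.2.2.2.1, hcomp _ hr.2.2 _ hs.2.2 hne.2.2.2.2.2,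
          hcomp _ hs.2.2 _ hvK hs.1, hwv.symm⟩
    · obtain ⟨q, hq, hqc⟩ := exists_rotation hc (u := u) (by
        rw [← List.mem_toFinset, hs]; exact hu)
      have hmem : ∀ x, x ∈ q ++ [u] → x ∈ K := fun x hx => hp.2.2 x (hq.mem_iff.1 hx)
      have hl : (q ++ [u] ++ [w, v]).length = 8 := by
        rw [List.length_append, hq.length_eq, ← hcard, hK6']; rfl
      refine hG _ hl ?_ ?_
      · refine List.nodup_append.2 ⟨hq.nodup_iff.2 hp.1, by simp [hwv.ne], ?_⟩
        intro x hx y hy hxy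
        subst hxy
        have := hmem _ hx
        simp only [List.mem_cons, List.not_mem_nil, or_false] at hy
        rcases hy with rfl | rfl
        exacts [hwK this, hvK this]
      · refine List.isChain_append.2 ⟨hqc, by simp [hwv], ?_⟩
        simpa using huw
  have haK : a ∈ K := hp.2.2 a (by simp)
  have hall := hZ.forall_mem (fun x => x ∈ K ∨ ∃ u ∈ K, G.Adj u x) (hKZ haK) (.inl haK) (by
    rintro u hu (huK | ⟨x, hx, hxu⟩) v hv huv
    · exact .inr ⟨u, huK, huv⟩
    · by_cases huK : u ∈ K
      · exact .inr ⟨u, huK, huv⟩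
      · exact .inl (hone u hu huK x hx hxu v hv huv ▸ hx))
  -- This bounds the degree sum of `Z` by `30 + 2 (|Z| - 6)`, which is below `4 |Z| + 6` once `|Z| >
  -- 6`.
  have := degSum_le_of_pendant (G := G) (K := K) (Z.card - K.card) Z hKZ
    (by have := Finset.card_le_card hKZ; omega) (fun w hw hwK => by
      obtain ⟨u, hu, huw⟩ := (hall w hw).resolve_left hwK
      exact degIn_le_length [u] fun v hv hwv => by simpa using hone w hw hwK u hu huw v hv hwv)
  have := degSum_le (G := G) K
  rw [hK6'] at *
  omega

lemma IsDenseMin.tight (hG : G.P8Free) {K Z : Finset V} (hK : IsDenseMin G K) (hKZ : K ⊆ Z)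
    (hZ : G.ConnOn Z) (h8 : 8 ≤ Z.card) : G.Tight K := by
  have hl : ∀ a b c d e f g, G.IsP7In K a b c d e f g →
      G.IsLongestIn K [a, b, c, d, e, f, g] := fun a b c d e f g h =>
    ⟨h.isPathIn, fun l' hl' => Nat.le_of_lt_succ (hG.length_lt hl')⟩
  refine ⟨hl, fun a b c d e f g h => hK.three_le (hl _ _ _ _ _ _ _ h),
    fun a b c d e f g h hga => hG.not_closed7 hZ hKZ h8 h.isPathIn rfl ?_⟩
  have := h.1
  simp [this, hga]

/-- Minimality excludes a block `K_4` that hangs on one vertex. -/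
lemma IsDenseMin.not_windmill {K : Finset V} (hK : IsDenseMin G K) {a b c d : V}
    (hab : a ≠ b) (hac : a ≠ c) (hbc : b ≠ c) (hda : d ≠ a) (hdb : d ≠ b) (hdc : d ≠ c)
    (ha : a ∈ K) (hb : b ∈ K) (hc : c ∈ K)
    (na : ∀ w ∈ K, G.Adj a w → w = b ∨ w = c ∨ w = d)
    (nb : ∀ w ∈ K, G.Adj b w → w = a ∨ w = c ∨ w = d)
    (nc : ∀ w ∈ K, G.Adj c w → w = a ∨ w = b ∨ w = d) : False := by
  have hb' : b ∈ K.erase a := by simp [hb, hab.symm]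
  have hc' : c ∈ (K.erase a).erase b := by simp [hc, hac.symm, hbc.symm]
  -- Removing `a`, `b`, `c` costs at most `3 + 2 + 1 = 6` edges, and the threshold drops by `2 * 3 =
  -- 6`. The rest stays connected because the block was attached only at `d`.
  have e1 := degSum_erase (G := G) ha
  have e2 := degSum_erase (G := G) hb'
  have e3 := degSum_erase (G := G) hc'
  have c1 := Finset.card_erase_add_one ha
  have c2 := Finset.card_erase_add_one hb'
  have c3 := Finset.card_erase_add_one hc'
  have d1 : G.degIn K a ≤ 3 := degIn_le_length [b, c, d] fun w hw h => by simpa using na w hw h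
  have d2 : G.degIn (K.erase a) b ≤ 2 := degIn_le_length [c, d] fun w hw h => by
    simp only [Finset.mem_erase] at hw
    simpa [hw.1] using nb w hw.2 h
  have d3 : G.degIn ((K.erase a).erase b) c ≤ 1 := degIn_le_length [d] fun w hw h => by
    simp only [Finset.mem_erase] at hw
    simpa [hw.1, hw.2.1] using nc w hw.2.2 h
  have hsub : ((K.erase a).erase b).erase c ⊆ K := by
    intro x hx
    simp only [Finset.mem_erase] at hx
    exact hx.2.2.2
  have := hK.min _ hsub ?_ (by have := hK.dense; omega)
  · omega
  have key : ∀ A ⊆ ((K.erase a).erase b).erase c, A.Nonempty → d ∉ A →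
      ¬ G.ClosedIn (((K.erase a).erase b).erase c) A := by
    intro A hA hne hd hcl
    obtain ⟨u, hu, w, hw, hwA, huw⟩ := hK.conn.exists_adj (hA.trans hsub) hne (by
      rintro rfl; have := hA ha; simp at this)
    refine hcl u hu w ?_ hwA huw
    have hu' := hA hu
    simp only [Finset.mem_erase] at hu' ⊢
    refine ⟨?_, ?_, ?_, hw⟩ <;> rintro rfl
    · rcases nc u hu'.2.2.2 huw.symm with rfl | rfl | rfl <;> tauto
    · rcases nb u hu'.2.2.2 huw.symm with rfl | rfl | rfl <;> tauto
    · rcases na u hu'.2.2.2 huw.symm with rfl | rfl | rfl <;> tauto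
  intro A hA hne hAK hcl
  by_cases hd : d ∈ A
  · exact key _ Finset.sdiff_subset (Finset.sdiff_nonempty.2 fun h' => hAK (hA.antisymm h'))
      (by simp [hd]) hcl.compl
  · exact key A hA hne hd hcl

end SimpleGraph

/-! ### The three-hub structure and the covering theorem. -/

namespace SimpleGraph

variable {V : Type*} {G : SimpleGraph V}

/-- Any vertex that can replace the first vertex of a path with three hubs sees only the hubs. -/
lemma Tight.adj_iff_hub {K : Finset V} (hK : G.Tight K) {w x₂ x₃ x₄ x₅ x₆ g : V}
    (h : G.IsP7In K w x₂ x₃ x₄ x₅ x₆ g) (h2 : G.Adj g x₂) (h3 : ¬ G.Adj g x₃) (h4 : G.Adj g x₄)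
    (h5 : ¬ G.Adj g x₅) (v : V) (hv : v ∈ K) :
    G.Adj w v ↔ v = x₂ ∨ v = x₄ ∨ v = x₆ := by
  have hp := hK.endPattern h
  have hc := hp.hc; have hd := hp.hd; have he := hp.he; have hf := hp.hf
  constructor
  · intro hwv
    rcases hp.mem v hv hwv with rfl | rfl | rfl | rfl | rfl <;> tauto
  · rintro (rfl | rfl | rfl)
    · exact h.1.1
    · tauto
    · tauto

/-- Rotations bring each of `a`, `c`, `e`, `g` to an end of a path of the same type, where
`Tight.adj_iff_hub` applies. The property then spreads along edges: a new vertex adjacent to a hub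
can itself be made the end of such a path. -/
lemma Tight.hubs {K : Finset V} (hK : G.Tight K) (hconn : G.ConnOn K) {a b c d e f g : V}
    (h : G.IsP7In K a b c d e f g) (hac : ¬ G.Adj a c) (had : G.Adj a d) (hae : ¬ G.Adj a e)
    (haf : G.Adj a f) : ∀ w ∈ K, w = b ∨ w = d ∨ w = f ∨
      ∀ v ∈ K, G.Adj w v ↔ v = b ∨ v = d ∨ v = f := by
  have hp := hK.endPattern h
  have hgb : G.Adj g b := by_contra fun h2 => hac (hp.hc.2 h2)
  have hgc : ¬ G.Adj g c := hp.hd.1 had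
  have hgd : G.Adj g d := by_contra fun h2 => hae (hp.he.2 h2)
  have hge : ¬ G.Adj g e := hp.hf.1 haf
  have hga : ¬ G.Adj g a := fun h' => hp.hg h'.symm
  have hrev := h.rev
  have hcN := hK.adj_iff_hub (h.flip3 had) hgb hga hgd hge
  have heN := hK.adj_iff_hub (hrev.flip3 hgd) haf hp.hg had hac
  have haN := hK.adj_iff_hub h hgb hgc hgd hge
  have hgN := hK.adj_iff_hub hrev haf hae had hac
  have hm := h.2.2
  have hne := h.2.1
  have hcf : G.Adj c f := (hcN f hm.2.2.2.2.2.1).2 (by simp)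
  have haK := hm.1
  have hpath : ∀ w ∈ K, w ∈ [a, b, c, d, e, f, g] → w = b ∨ w = d ∨ w = f ∨
      ∀ v ∈ K, G.Adj w v ↔ v = b ∨ v = d ∨ v = f := by
    intro w _ hw
    simp only [List.mem_cons, List.not_mem_nil, or_false] at hw
    rcases hw with rfl | rfl | rfl | rfl | rfl | rfl | rfl
    · exact .inr (.inr (.inr haN))
    · exact .inl rfl
    · exact .inr (.inr (.inr hcN))
    · exact .inr (.inl rfl)
    · exact .inr (.inr (.inr fun v hv => (heN v hv).trans (by tauto)))
    · exact .inr (.inr (.inl rfl))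
    · exact .inr (.inr (.inr fun v hv => (hgN v hv).trans (by tauto)))
  refine hconn.forall_mem _ haK (hpath a haK (by simp)) fun u hu hPu w hw huw => ?_
  by_cases hwP : w ∈ [a, b, c, d, e, f, g]
  · exact hpath w hw hwP
  have hh := h
  obtain ⟨⟨e1, e2, e3, e4, e5, e6⟩, -, -⟩ := hh
  simp only [List.mem_cons, List.not_mem_nil, or_false, not_or] at hwP
  rcases hPu with rfl | rfl | rfl | hPu
  · refine .inr (.inr (.inr (hK.adj_iff_hub (g := g) (w := w) (x₂ := u) (x₃ := c) (x₄ := d)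
      (x₅ := e) (x₆ := f) ⟨⟨huw.symm, e2, e3, e4, e5, e6⟩, by tauto, by tauto⟩ hgb hgc hgd hge)))
  -- For the middle hub the path is rerouted as `w d a b c f g`, using the chords `da` and `cf`.
  · refine .inr (.inr (.inr fun v hv => (hK.adj_iff_hub (g := g) (w := w) (x₂ := u) (x₃ := a)
      (x₄ := b) (x₅ := c) (x₆ := f)
      ⟨⟨huw.symm, had.symm, e1, e2, hcf, e6⟩, ?_, by tauto⟩ hgd hga hgb hgc v hv).trans (by tauto)))
    have hac := hne.2.1
    have had' := hne.2.2.1.symm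
    have hbd := hne.2.2.2.2.2.2.2.1.symm
    have hcd := hne.2.2.2.2.2.2.2.2.2.2.2.1.symm
    tauto
  · refine .inr (.inr (.inr fun v hv => (hK.adj_iff_hub (g := a) (w := w) (x₂ := u) (x₃ := e)
      (x₄ := d) (x₅ := c) (x₆ := b)
      ⟨⟨huw.symm, e5.symm, e4.symm, e3.symm, e2.symm, e1.symm⟩, ?_, by tauto⟩
      haf hae had hac v hv).trans (by tauto)))
    have := hrev.2.1
    tauto
  · have := (hPu w hw).1 huw
    tauto

/-- The three hubs of a dense minimal set cover all edges of every connected set around it. -/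
lemma P8Free.cover_of_hubs (hG : G.P8Free) {K Z : Finset V} (hKZ : K ⊆ Z) (hZ : G.ConnOn Z)
    {b d f : V} (hbd : b ≠ d) (hbf : b ≠ f) (hdf : d ≠ f) (hb : b ∈ K) (hd : d ∈ K) (hf : f ∈ K)
    (h7 : 7 ≤ K.card)
    (hK : ∀ w ∈ K, w = b ∨ w = d ∨ w = f ∨ ∀ v ∈ K, G.Adj w v ↔ v = b ∨ v = d ∨ v = f) :
    ∀ u ∈ Z, ∀ v ∈ Z, G.Adj u v → u ∈ ({b, d, f} : Finset V) ∨ v ∈ ({b, d, f} : Finset V) := by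
  set H : Finset V := {b, d, f} with hH
  have hH3 : H.card = 3 := Finset.card_eq_three.2 ⟨b, d, f, hbd, hbf, hdf, rfl⟩
  have hHK : H ⊆ K := by simp [Finset.insert_subset_iff, *]
  have hfull : ∀ x ∈ K, x ∉ H → ∀ v ∈ H, G.Adj x v := by
    intro x hx hxH v hv
    have := hK x hx
    simp only [hH, Finset.mem_insert, Finset.mem_singleton, not_or] at hxH hv
    exact ((this.resolve_left hxH.1).resolve_left hxH.2.1).resolve_left hxH.2.2 v
      (by rcases hv with rfl | rfl | rfl <;> assumption) |>.2 hv
  have honly : ∀ x ∈ K, x ∉ H → ∀ v ∈ K, G.Adj x v → v ∈ H := by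
    intro x hx hxH v hv hxv
    have := hK x hx
    simp only [hH, Finset.mem_insert, Finset.mem_singleton, not_or] at hxH ⊢
    exact ((this.resolve_left hxH.1).resolve_left hxH.2.1).resolve_left hxH.2.2 v hv |>.1 hxv
  obtain ⟨p, hp, q, hq, r, hr, s, hs, hne⟩ := exists_four (A := K \ H) (by
    rw [Finset.card_sdiff_of_subset hHK, hH3]; omega)
  have hbH : b ∈ H := by simp [hH]
  have hdH : d ∈ H := by simp [hH]
  have hfH : f ∈ H := by simp [hH]
  -- Otherwise `w x b y d z f t` is a path, with `y`, `z`, `t` further non-hubs of `K`; `7 ≤ K.card`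
  -- supplies the four non-hubs.
  have hout : ∀ x ∈ K, x ∉ H → ∀ w ∈ Z, w ∉ K → ¬ G.Adj x w := by
    intro x hx hxH w hw hwK hxw
    obtain ⟨y, hy, z, hz, t, ht, t', ht', hne'⟩ : ∃ y ∈ K \ H, ∃ z ∈ K \ H, ∃ t ∈ K \ H,
        ∃ _t' ∈ K \ H, x ≠ y ∧ x ≠ z ∧ x ≠ t ∧ y ≠ z ∧ y ≠ t ∧ z ≠ t := by
      by_cases h1 : x = p
      · exact ⟨q, hq, r, hr, s, hs, p, hp, by grind⟩
      by_cases h2 : x = q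
      · exact ⟨p, hp, r, hr, s, hs, p, hp, by grind⟩
      by_cases h3 : x = r
      · exact ⟨p, hp, q, hq, s, hs, p, hp, by grind⟩
      · exact ⟨p, hp, q, hq, r, hr, p, hp, by grind⟩
    rw [Finset.mem_sdiff] at hy hz ht
    refine hG.elim (a := w) (b := x) (c := b) (d := y) (e := d) (f := z) (g := f) (k := t)
      ⟨hxw.symm, hfull _ hx hxH _ hbH, (hfull _ hy.1 hy.2 _ hbH).symm, hfull _ hy.1 hy.2 _ hdH,
        (hfull _ hz.1 hz.2 _ hdH).symm, hfull _ hz.1 hz.2 _ hfH,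
        (hfull _ ht.1 ht.2 _ hfH).symm⟩ ?_
    have hHK' : ∀ y ∈ H, y ∈ K := fun y hy => hHK hy
    clear_value H
    clear hH hK honly hfull hH3 h7 hHK hKZ
    grind (splits := 30)
  -- Otherwise `w x` followed by an alternating path from `u` through the three hubs and three
  -- non-hubs has eight vertices.
  have hpend : ∀ x ∈ Z, x ∉ K → ∀ u ∈ H, G.Adj u x → ∀ w ∈ Z, G.Adj x w → w ∈ H := by
    intro x hx hxK u hu hux w hw hxw
    by_contra hwH
    by_cases hwK : w ∈ K
    · exact hout w hwK hwH x hx hxK hxw.symm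
    obtain ⟨u', hu', u'', hu'', huu⟩ : ∃ u' ∈ H, ∃ u'' ∈ H, u ≠ u' ∧ u ≠ u'' ∧ u' ≠ u'' := by
      simp only [hH, Finset.mem_insert, Finset.mem_singleton] at hu
      rcases hu with rfl | rfl | rfl
      · exact ⟨d, hdH, f, hfH, hbd, hbf, hdf⟩
      · exact ⟨b, hbH, f, hfH, hbd.symm, hdf, hbf⟩
      · exact ⟨b, hbH, d, hdH, hbf.symm, hdf.symm, hbd⟩
    rw [Finset.mem_sdiff] at hp hq hr
    have hHK' : ∀ y ∈ H, y ∈ K := fun y hy => hHK hy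
    clear_value H
    refine hG.elim (a := w) (b := x) (c := u) (d := p) (e := u') (f := q) (g := u'') (k := r)
      ⟨hxw.symm, hux.symm, (hfull _ hp.1 hp.2 _ hu).symm, hfull _ hp.1 hp.2 _ hu',
        (hfull _ hq.1 hq.2 _ hu').symm, hfull _ hq.1 hq.2 _ hu'',
        (hfull _ hr.1 hr.2 _ hu'').symm⟩ ?_
    clear hH hK honly hout hfull hH3 h7 hHK hKZ
    grind (splits := 30)
  have hall := hZ.forall_mem (fun x => x ∈ H ∨ ∀ w ∈ Z, G.Adj x w → w ∈ H) (hKZ hb) (.inl hbH) (by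
    rintro u hu hPu v hv huv
    by_cases hvH : v ∈ H
    · exact .inl hvH
    rcases hPu with huH | hPu
    · right
      intro w hw hvw
      by_cases hvK : v ∈ K
      · by_cases hwK : w ∈ K
        · exact honly v hvK hvH w hwK hvw
        · exact (hout v hvK hvH w hw hwK hvw).elim
      · exact hpend v hv hvK u huH huv w hw hvw
    · exact .inl (hPu v hv huv))
  exact fun u hu v hv huv => (hall u hu).imp_right fun h => h v hv huv

/-- In a `P_8`-free graph, the edges of a connected set on at least eight vertices with at least
`2 |Z| + 3` edges are covered by three vertices. -/
theorem P8Free.exists_cover (hG : G.P8Free) {Z : Finset V} (hZ : G.ConnOn Z) (h8 : 8 ≤ Z.card)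
    (hD : 4 * Z.card + 6 ≤ G.degSum Z) : ∃ H ⊆ Z, H.card = 3 ∧
      ∀ u ∈ Z, ∀ v ∈ Z, G.Adj u v → u ∈ H ∨ v ∈ H := by
  obtain ⟨K, hKZ, hK⟩ := exists_isDenseMin hZ hD
  rcases hK.closed_or_seven hG with ⟨a, t, hp, hc, hs⟩ | ⟨l, hl, h7⟩
  · exact (hK.not_spanning_cycle hG hKZ hZ h8 hD hp hc hs).elim
  have hT := hK.tight hG hKZ hZ h8
  obtain ⟨a, b, c, d, e, f, g, rfl⟩ : ∃ a b c d e f g, l = [a, b, c, d, e, f, g] := by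
    match l, h7 with
    | [a, b, c, d, e, f, g], _ => exact ⟨a, b, c, d, e, f, g, rfl⟩
  have h := hl.1.isP7In
  have hm := h.2.2
  have hne := h.2.1
  have hp := hT.endPattern h
  rcases hT.pattern_cases h with ⟨hac, had, hae, haf⟩ | ⟨hac, had, hae, haf⟩
  -- Rotations also put `b` and `c` at the end of the path, so `a`, `b`, `c` see nothing outside
  -- `{a, b, c, d}`.
  · exfalso
    have hb := hT.endPattern (h.flip2 hac)
    have hc := hT.endPattern (h.flip3 had)
    have hgd : G.Adj g d := by_contra fun h2 => hae (hp.he.2 h2)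
    have hge : G.Adj g e := by_contra fun h2 => haf (hp.hf.2 h2)
    refine hK.not_windmill (a := a) (b := b) (c := c) (d := d) hne.1 hne.2.1
      hne.2.2.2.2.2.2.1 hne.2.2.1.symm hne.2.2.2.2.2.2.2.1.symm
      hne.2.2.2.2.2.2.2.2.2.2.2.1.symm hm.1 hm.2.1 hm.2.2.1 ?_ ?_ ?_
    · intro w hw haw
      rcases hp.mem w hw haw with rfl | rfl | rfl | rfl | rfl
      exacts [.inl rfl, .inr (.inl rfl), .inr (.inr rfl), (hae haw).elim, (haf haw).elim]
    · intro w hw hbw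
      rcases hb.mem w hw hbw with rfl | rfl | rfl | rfl | rfl
      exacts [.inl rfl, .inr (.inl rfl), .inr (.inr rfl), (hb.he.1 hbw hgd).elim,
        (hb.hf.1 hbw hge).elim]
    · intro w hw hcw
      rcases hc.mem w hw hcw with rfl | rfl | rfl | rfl | rfl
      exacts [.inr (.inl rfl), .inl rfl, .inr (.inr rfl), (hc.he.1 hcw hgd).elim,
        (hc.hf.1 hcw hge).elim]
  · have hbd : b ≠ d := hne.2.2.2.2.2.2.2.1
    have hbf : b ≠ f := hne.2.2.2.2.2.2.2.2.2.1
    have hdf : d ≠ f := hne.2.2.2.2.2.2.2.2.2.2.2.2.2.2.2.2.1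
    have hc3 : ({b, d, f} : Finset V).card = 3 :=
      Finset.card_eq_three.2 ⟨b, d, f, hbd, hbf, hdf, rfl⟩
    refine ⟨{b, d, f}, ?_, hc3, hG.cover_of_hubs hKZ hZ hbd hbf hdf hm.2.1 hm.2.2.2.1
      hm.2.2.2.2.2.1 ?_ (hT.hubs hK.conn h hac had hae haf)⟩
    · simp [Finset.insert_subset_iff, hKZ hm.2.1, hKZ hm.2.2.2.1, hKZ hm.2.2.2.2.2.1]
    · have := hl.1.length_le
      simpa using this

end SimpleGraph

/-! ### Four vertices with large neighbourhoods in a small set. -/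

/-- Four vertices outside `Y` together with sets of neighbours in `Y`. -/
structure SimpleGraph.Quad {V : Type*} (G : SimpleGraph V) (Y : Finset V) (p q r s : V)
    (P Q R S : Finset V) : Prop where
  ne : p ≠ q ∧ p ≠ r ∧ p ≠ s ∧ q ≠ r ∧ q ≠ s ∧ r ≠ s
  notMem : p ∉ Y ∧ q ∉ Y ∧ r ∉ Y ∧ s ∉ Y
  sub : P ⊆ Y ∧ Q ⊆ Y ∧ R ⊆ Y ∧ S ⊆ Y
  adjP : ∀ y ∈ P, G.Adj p y
  adjQ : ∀ y ∈ Q, G.Adj q y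
  adjR : ∀ y ∈ R, G.Adj r y
  adjS : ∀ y ∈ S, G.Adj s y

namespace SimpleGraph

variable {V : Type*} {G : SimpleGraph V} {Y : Finset V} {p q r s : V} {P Q R S : Finset V}

namespace Quad

lemma swap12 (h : G.Quad Y p q r s P Q R S) : G.Quad Y q p r s Q P R S :=
  ⟨by have := h.ne; tauto, by have := h.notMem; tauto, by have := h.sub; tauto,
    h.adjQ, h.adjP, h.adjR, h.adjS⟩

lemma swap23 (h : G.Quad Y p q r s P Q R S) : G.Quad Y p r q s P R Q S :=
  ⟨by have := h.ne; tauto, by have := h.notMem; tauto, by have := h.sub; tauto,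
    h.adjP, h.adjR, h.adjQ, h.adjS⟩

lemma swap34 (h : G.Quad Y p q r s P Q R S) : G.Quad Y p q s r P Q S R :=
  ⟨by have := h.ne; tauto, by have := h.notMem; tauto, by have := h.sub; tauto,
    h.adjP, h.adjQ, h.adjS, h.adjR⟩

lemma swap13 (h : G.Quad Y p q r s P Q R S) : G.Quad Y r q p s R Q P S :=
  h.swap12.swap23.swap12

/-- The forbidden path is `p y₁ q y₂ r y₃ s y₄`; the swaps above provide the other orders. -/
lemma alt (h : G.Quad Y p q r s P Q R S) (hG : G.P8Free) {y₁ y₂ y₃ y₄ : V} (h1 : y₁ ∈ P)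
    (h1' : y₁ ∈ Q) (h2 : y₂ ∈ Q) (h2' : y₂ ∈ R) (h3 : y₃ ∈ R) (h3' : y₃ ∈ S) (h4 : y₄ ∈ S)
    (hne : y₁ ≠ y₂ ∧ y₁ ≠ y₃ ∧ y₁ ≠ y₄ ∧ y₂ ≠ y₃ ∧ y₂ ≠ y₄ ∧ y₃ ≠ y₄) : False := by
  obtain ⟨n1, n2, n3, n4, n5, n6⟩ := h.ne
  obtain ⟨m1, m2, m3, m4, m5, m6⟩ := hne
  have k1 := h.sub.1 h1
  have k2 := h.sub.2.1 h2
  have k3 := h.sub.2.2.1 h3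
  have k4 := h.sub.2.2.2 h4
  have aux : ∀ x ∉ Y, x ≠ y₁ ∧ x ≠ y₂ ∧ x ≠ y₃ ∧ x ≠ y₄ := by
    intro x hx
    refine ⟨?_, ?_, ?_, ?_⟩ <;> rintro rfl <;> contradiction
  obtain ⟨a1, a2, a3, a4⟩ := aux p h.notMem.1
  obtain ⟨b1, b2, b3, b4⟩ := aux q h.notMem.2.1
  obtain ⟨c1, c2, c3, c4⟩ := aux r h.notMem.2.2.1
  obtain ⟨d1, d2, d3, d4⟩ := aux s h.notMem.2.2.2
  exact hG.elim (a := p) (b := y₁) (c := q) (d := y₂) (e := r) (f := y₃) (g := s) (k := y₄)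
    ⟨h.adjP _ h1, (h.adjQ _ h1').symm, h.adjQ _ h2, (h.adjR _ h2').symm, h.adjR _ h3,
      (h.adjS _ h3').symm, h.adjS _ h4⟩
    ⟨n1, a2, n2, a3, n3, a4, m1, c1.symm, m2, d1.symm, m3, n4, b3, n5, b4, m4, d2.symm, m5, n6, c4,
      m6⟩

/-- The situation where the set `S` meets the ends of the path `p y q y' r` only in `y` and `y'`,
and where the ends have a further common neighbour. -/
lemma disjoint_of_hexagon (h : G.Quad Y p q r s P Q R S) (hG : G.P8Free) (hS : 3 ≤ S.card)
    {y y' z : V} (hyP : y ∈ P) (hyQ : y ∈ Q) (hyQ' : y' ∈ Q) (hyR : y' ∈ R) (hne : y ≠ y')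
    (hSP : ∀ t ∈ S, t ∈ P → t = y ∨ t = y') (hzP : z ∈ P) (hzR : z ∈ R) (hzy : z ≠ y)
    (hzy' : z ≠ y') : y ∉ S ∧ y' ∉ S := by
  obtain ⟨w, hw, hw'⟩ := exists_avoiding (S := S) [y, y'] (by simp; omega)
  simp only [List.mem_cons, List.not_mem_nil, or_false, not_or] at hw'
  have hzS : z ∉ S := fun hz => by rcases hSP z hz hzP with h | h <;> contradiction
  have hwz : w ≠ z := fun h => hzS (h ▸ hw)
  constructor
  -- The path `p z r y' q y s w` runs around the hexagon and leaves it at `y`; the other case is its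
  -- mirror image.
  · intro hyS
    exact h.swap23.alt hG hzP hzR hyR hyQ' hyQ hyS hw
      ⟨hzy', hzy, hwz.symm, hne.symm, Ne.symm hw'.2, Ne.symm hw'.1⟩
  · intro hyS
    exact h.swap13.swap23.alt hG hzR hzP hyP hyQ hyQ' hyS hw
      ⟨hzy, hzy', hwz.symm, hne, Ne.symm hw'.1, Ne.symm hw'.2⟩

/-- Outside `{y, y'}` the sets `P`, `R`, `S` are disjoint petals of size at least `k - 2` in a set
of size at most `3k - 6`. So they fill it, and all three sets contain `y` and `y'`. A further
neighbour of `q` lies in some petal and links `q` to the owner of that petal, while `y` and `y'`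
link the rest. -/
lemma not_sunflower (h : G.Quad Y p q r s P Q R S) (hG : G.P8Free) {k : ℕ} (hk : 3 ≤ k)
    (hY : Y.card + 4 ≤ 3 * k) (hP : k ≤ P.card) (hQ : k ≤ Q.card) (hR : k ≤ R.card)
    (hS : k ≤ S.card) {y y' : V} (hyP : y ∈ P) (hyQ : y ∈ Q) (hyQ' : y' ∈ Q) (hyR : y' ∈ R)
    (hne : y ≠ y') (hSP : ∀ t ∈ S, t ∈ P → t = y ∨ t = y') (hSR : ∀ t ∈ S, t ∈ R → t = y ∨ t = y')
    (hPR : ∀ t ∈ P, t ∈ R → t = y ∨ t = y') : False := by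
  have hsub := h.sub
  have hyY := hsub.1 hyP
  have hyY' := hsub.2.1 hyQ'
  have e0 : ((Y.erase y).erase y').card + 2 = Y.card := by
    have := Finset.card_erase_add_one hyY
    have := Finset.card_erase_add_one (s := Y.erase y) (a := y') (by simp [hyY', hne.symm])
    omega
  have key : ∀ T : Finset V, k ≤ T.card →
      k ≤ ((T.erase y).erase y').card + (if y ∈ T then 1 else 0) + (if y' ∈ T then 1 else 0) := by
    intro T hT
    rw [Finset.card_erase_eq_ite, Finset.card_erase_eq_ite]
    simp only [Finset.mem_erase, hne.symm, ne_eq, not_false_eq_true, true_and]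
    split_ifs <;> omega
  set T := ((P.erase y).erase y') ∪ ((R.erase y).erase y') ∪ ((S.erase y).erase y') with hT
  have hdis : T.card = ((P.erase y).erase y').card + ((R.erase y).erase y').card +
      ((S.erase y).erase y').card := by
    rw [hT, Finset.card_union_of_disjoint, Finset.card_union_of_disjoint]
    · rw [Finset.disjoint_left]
      intro t ht ht'
      simp only [Finset.mem_erase] at ht ht'
      rcases hPR t ht.2.2 ht'.2.2 with rfl | rfl <;> tauto
    · rw [Finset.disjoint_left]
      intro t ht ht'
      simp only [Finset.mem_erase, Finset.mem_union] at ht ht'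
      rcases ht with ht | ht
      · rcases hSP t ht'.2.2 ht.2.2 with rfl | rfl <;> tauto
      · rcases hSR t ht'.2.2 ht.2.2 with rfl | rfl <;> tauto
  have hTY : T ⊆ (Y.erase y).erase y' := by
    refine Finset.union_subset (Finset.union_subset ?_ ?_) ?_
    · exact Finset.erase_subset_erase _ (Finset.erase_subset_erase _ hsub.1)
    · exact Finset.erase_subset_erase _ (Finset.erase_subset_erase _ hsub.2.2.1)
    · exact Finset.erase_subset_erase _ (Finset.erase_subset_erase _ hsub.2.2.2)
  have hTc := Finset.card_le_card hTY
  have kP := key P hP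
  have kR := key R hR
  have kS := key S hS
  have hle : ∀ (T : Finset V) (x : V), (if x ∈ T then 1 else 0) ≤ 1 := fun T x => by
    split_ifs <;> omega
  have hyR' : y ∈ R := by
    by_contra hc
    have := hle P y; have := hle P y'; have := hle R y'; have := hle S y; have := hle S y'
    rw [if_neg hc] at kR; omega
  have hyS : y ∈ S := by
    by_contra hc
    have := hle P y; have := hle P y'; have := hle R y'; have := hle R y; have := hle S y'
    rw [if_neg hc] at kS; omega
  have hyS' : y' ∈ S := by
    by_contra hc
    have := hle P y; have := hle P y'; have := hle R y'; have := hle R y; have := hle S y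
    rw [if_neg hc] at kS; omega
  have hyP' : y' ∈ P := by
    by_contra hc
    have := hle P y; have := hle R y'; have := hle R y; have := hle S y; have := hle S y'
    rw [if_neg hc] at kP; omega
  have hTeq : T = (Y.erase y).erase y' := Finset.eq_of_subset_of_card_le hTY (by
    have := hle P y; have := hle P y'; have := hle R y; have := hle R y'
    have := hle S y; have := hle S y'; omega)
  obtain ⟨v, hv, hv'⟩ := exists_avoiding (S := Q) [y, y'] (by simp; omega)
  obtain ⟨w, hw, hw'⟩ := exists_avoiding (S := S) [y, y'] (by simp; omega)
  obtain ⟨x, hx, hx'⟩ := exists_avoiding (S := R) [y, y'] (by simp; omega)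
  simp only [List.mem_cons, List.not_mem_nil, or_false, not_or] at hv' hw' hx'
  have hvT : v ∈ T := by rw [hTeq]; simp [hv', hsub.2.1 hv]
  rw [hT, Finset.mem_union, Finset.mem_union] at hvT
  simp only [Finset.mem_erase] at hvT
  rcases hvT with (hvT | hvT) | hvT
  · have hvw : v ≠ w := fun h => by
      subst h; rcases hSP v hw hvT.2.2 with rfl | rfl <;> tauto
    exact h.alt hG hvT.2.2 hv hyQ hyR' hyR hyS' hw
      ⟨hv'.1, hv'.2, hvw, hne, Ne.symm hw'.1, Ne.symm hw'.2⟩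
  · have hvw : v ≠ w := fun h => by
      subst h; rcases hSR v hw hvT.2.2 with rfl | rfl <;> tauto
    exact h.swap13.alt hG hvT.2.2 hv hyQ hyP hyP' hyS' hw
      ⟨hv'.1, hv'.2, hvw, hne, Ne.symm hw'.1, Ne.symm hw'.2⟩
  · have hvx : v ≠ x := fun h => by
      subst h; rcases hSR v hvT.2.2 hx with rfl | rfl <;> tauto
    exact h.swap34.swap13.alt hG hvT.2.2 hv hyQ hyP hyP' hyR hx
      ⟨hv'.1, hv'.2, hvx, hne, Ne.symm hx'.1, Ne.symm hx'.2⟩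

/-- Three vertices with many neighbours lie on a path, or one neighbourhood is disjoint from the
two others. -/
lemma path_or_disjoint {k : ℕ} (hP : k ≤ P.card) (hQ : k ≤ Q.card) (hR : k ≤ R.card)
    (hPY : P ⊆ Y) (hQY : Q ⊆ Y) (hRY : R ⊆ Y) (hY : Y.card + 4 ≤ 3 * k) :
    (∃ y y', y ≠ y' ∧ y ∈ P ∧ y ∈ Q ∧ y' ∈ Q ∧ y' ∈ R) ∨
    (∃ y y', y ≠ y' ∧ y ∈ P ∧ y ∈ R ∧ y' ∈ R ∧ y' ∈ Q) ∨
    (∃ y y', y ≠ y' ∧ y ∈ Q ∧ y ∈ P ∧ y' ∈ P ∧ y' ∈ R) ∨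
    (Disjoint P Q ∧ Disjoint P R) ∨ (Disjoint P Q ∧ Disjoint Q R) ∨
      (Disjoint P R ∧ Disjoint Q R) := by
  by_contra! hcon
  obtain ⟨h1, h2, h3, h4, h5, h6⟩ := hcon
  -- If every alternative fails, the three sets meet pairwise in at most one common vertex `y`, and
  -- without it they occupy at least `3 (k - 1)` vertices, more than `Y` has.
  have h7 : ∃ y, (∀ t ∈ P, t ∈ Q → t = y) ∧ (∀ t ∈ Q, t ∈ R → t = y) ∧
      (∀ t ∈ P, t ∈ R → t = y) := by
    simp only [Finset.disjoint_left] at h4 h5 h6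
    push Not at h4 h5 h6
    by_cases hd : ∀ ⦃a⦄, a ∈ P → a ∉ Q
    · obtain ⟨a, ha⟩ := h4 hd
      obtain ⟨b, hb⟩ := h5 hd
      grind
    · push Not at hd
      obtain ⟨a, ha, ha'⟩ := hd
      refine ⟨a, ?_⟩
      by_cases hd' : ∀ ⦃a⦄, a ∈ P → a ∉ R
      · obtain ⟨b, hb⟩ := h6 hd'
        grind
      · grind
  obtain ⟨y, y1, y2, y3⟩ := h7
  have hdis : ((P.erase y) ∪ (Q.erase y) ∪ (R.erase y)).card =
      (P.erase y).card + (Q.erase y).card + (R.erase y).card := by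
    rw [Finset.card_union_of_disjoint, Finset.card_union_of_disjoint]
    · rw [Finset.disjoint_left]; grind
    · rw [Finset.disjoint_left]; grind
  have hsub : ((P.erase y) ∪ (Q.erase y) ∪ (R.erase y)) ⊆ Y := by grind
  have := Finset.card_le_card hsub
  have := Finset.pred_card_le_card_erase (s := P) (a := y)
  have := Finset.pred_card_le_card_erase (s := Q) (a := y)
  have := Finset.pred_card_le_card_erase (s := R) (a := y)
  omega

lemma eq_sdiff_of_disjoint {k : ℕ} {A B : Finset V} (hA : k ≤ A.card) (hB : k ≤ B.card)
    (hAY : A ⊆ Y) (hBY : B ⊆ Y) (hY : Y.card ≤ 2 * k) (h : Disjoint A B) : A = Y \ B := by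
  refine Finset.eq_of_subset_of_card_le (fun x hx => Finset.mem_sdiff.2
    ⟨hAY hx, Finset.disjoint_left.1 h hx⟩) ?_
  rw [Finset.card_sdiff_of_subset hBY]
  omega

/-- Four vertices with four neighbours each in a set of at most eight vertices. -/
lemma eq_of_path (h : G.Quad Y p q r s P Q R S) (hG : G.P8Free) (hY : Y.card ≤ 8)
    (hP : 4 ≤ P.card) (hQ : 4 ≤ Q.card) (hR : 4 ≤ R.card) (hS : 4 ≤ S.card) {y y' : V}
    (hyP : y ∈ P) (hyQ : y ∈ Q) (hyQ' : y' ∈ Q) (hyR : y' ∈ R) (hne : y ≠ y') :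
    P = Y \ S ∧ Q = Y \ S ∧ R = Y \ S := by
  have hSP : ∀ t ∈ S, t ∈ P → t = y ∨ t = y' := by
    by_contra! hc
    obtain ⟨t, htS, htP, ht⟩ := hc
    obtain ⟨w, hw, hw'⟩ := exists_avoiding (S := R) [t, y, y'] (by simp; omega)
    simp only [List.mem_cons, List.not_mem_nil, or_false, not_or] at hw'
    exact h.swap34.swap23.swap12.swap34.swap34.alt hG htS htP hyP hyQ hyQ' hyR hw
      ⟨ht.1, ht.2, Ne.symm hw'.1, hne, Ne.symm hw'.2.1, Ne.symm hw'.2.2⟩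
  have hSR : ∀ t ∈ S, t ∈ R → t = y ∨ t = y' := by
    by_contra! hc
    obtain ⟨t, htS, htR, ht⟩ := hc
    obtain ⟨w, hw, hw'⟩ := exists_avoiding (S := P) [t, y, y'] (by simp; omega)
    simp only [List.mem_cons, List.not_mem_nil, or_false, not_or] at hw'
    exact h.swap13.swap34.swap23.swap12.alt hG htS htR hyR hyQ' hyQ hyP hw
      ⟨ht.2, ht.1, Ne.symm hw'.1, hne.symm, Ne.symm hw'.2.2, Ne.symm hw'.2.1⟩
  -- A further common neighbour of `p` and `r` closes a hexagon, which forces `S` to be disjoint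
  -- from the other three sets; without one, `not_sunflower` applies.
  by_cases hz : ∃ z, z ∈ P ∧ z ∈ R ∧ z ≠ y ∧ z ≠ y'
  · obtain ⟨z, hzP, hzR, hzy, hzy'⟩ := hz
    obtain ⟨n1, n2⟩ := h.disjoint_of_hexagon hG (by omega) hyP hyQ hyQ' hyR hne hSP hzP hzR hzy hzy'
    have hPS : Disjoint P S := Finset.disjoint_left.2 fun t htP htS => by
      rcases hSP t htS htP with rfl | rfl <;> contradiction
    have hRS : Disjoint R S := Finset.disjoint_left.2 fun t htR htS => by
      rcases hSR t htS htR with rfl | rfl <;> contradiction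
    have hQS : Disjoint Q S := Finset.disjoint_left.2 fun u huQ huS => by
      obtain ⟨w, hw, hw'⟩ := exists_avoiding (S := S) [u] (by simp; omega)
      simp only [List.mem_singleton] at hw'
      exact h.swap23.alt hG hzP hzR hyR hyQ' huQ huS hw
        ⟨hzy', fun e => Finset.disjoint_left.1 hPS hzP (e ▸ huS),
          fun e => Finset.disjoint_left.1 hPS hzP (e ▸ hw), fun e => n2 (e ▸ huS),
          fun e => n2 (e ▸ hw), Ne.symm hw'⟩
    exact ⟨eq_sdiff_of_disjoint hP hS h.sub.1 h.sub.2.2.2 hY hPS,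
      eq_sdiff_of_disjoint hQ hS h.sub.2.1 h.sub.2.2.2 hY hQS,
      eq_sdiff_of_disjoint hR hS h.sub.2.2.1 h.sub.2.2.2 hY hRS⟩
  · push Not at hz
    exact (h.not_sunflower hG (k := 4) (by omega) (by omega) hP hQ hR hS hyP hyQ hyQ' hyR hne hSP hSR
      fun t htP htR => or_iff_not_imp_left.2 fun h => hz t htP htR h).elim

/-- Four vertices with four neighbours each in a set of at most eight vertices: two of the
neighbourhoods are equal or complementary. -/
lemma eq_or_eq_sdiff (h : G.Quad Y p q r s P Q R S) (hG : G.P8Free) (hY : Y.card ≤ 8)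
    (hP : 4 ≤ P.card) (hQ : 4 ≤ Q.card) (hR : 4 ≤ R.card) (hS : 4 ≤ S.card) :
    P = Q ∨ P = Y \ Q := by
  obtain ⟨sP, sQ, sR, sS⟩ := h.sub
  rcases path_or_disjoint hP hQ hR sP sQ sR (by omega) with ⟨y, y', e⟩ | ⟨y, y', e⟩ | ⟨y, y', e⟩ |
    e | e | e
  · obtain ⟨h1, h2, h3⟩ := h.eq_of_path hG hY hP hQ hR hS e.2.1 e.2.2.1 e.2.2.2.1 e.2.2.2.2 e.1
    exact .inl (h1.trans h2.symm)
  · obtain ⟨h1, h2, h3⟩ :=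
      h.swap23.eq_of_path hG hY hP hR hQ hS e.2.1 e.2.2.1 e.2.2.2.1 e.2.2.2.2 e.1
    exact .inl (h1.trans h3.symm)
  · obtain ⟨h1, h2, h3⟩ :=
      h.swap12.eq_of_path hG hY hQ hP hR hS e.2.1 e.2.2.1 e.2.2.2.1 e.2.2.2.2 e.1
    exact .inl (h2.trans h1.symm)
  · exact .inr (eq_sdiff_of_disjoint hP hQ sP sQ hY e.1)
  · exact .inr (eq_sdiff_of_disjoint hP hQ sP sQ hY e.1)
  · left
    rw [eq_sdiff_of_disjoint hP hR sP sR hY e.1, eq_sdiff_of_disjoint hQ hR sQ sR hY e.2]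

/-- Here `s t p y q y' r` is a path, so its ends see only `y`, `y'`, `t`. The new adjacencies allow
reroutings that put `p` or `q` at an end, and all four sets equal `{y, y', t}`. -/
lemma eq_of_common {y y' t : V} (h : G.Quad Y p q r s P Q R S) (hG : G.P8Free) (hP : 3 ≤ P.card)
    (hQ : 3 ≤ Q.card) (hR : 3 ≤ R.card) (hS : 3 ≤ S.card)
    (hyP : y ∈ P) (hyQ : y ∈ Q) (hyQ' : y' ∈ Q) (hyR : y' ∈ R) (hne : y ≠ y')
    (htS : t ∈ S) (htP : t ∈ P) (hty : t ≠ y) (hty' : t ≠ y') : P = R ∧ Q = R ∧ S = R := by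
  have h3 : ({y, y', t} : Finset V).card ≤ 3 := Finset.card_le_three
  have key : ∀ T : Finset V, 3 ≤ T.card → (∀ w ∈ T, w = y ∨ w = y' ∨ w = t) → T = {y, y', t} := by
    intro T hT hw
    exact Finset.eq_of_subset_of_card_le (fun w hwT => by simpa using hw w hwT) (h3.trans hT)
  have hR' : R = {y, y', t} := key R hR fun w hw => by
    by_contra! hc
    exact h.swap34.swap23.swap12.alt hG htS htP hyP hyQ hyQ' hyR hw
      ⟨hty, hty', hc.2.2.symm, hne, hc.1.symm, hc.2.1.symm⟩
  have hS' : S = {y, y', t} := key S hS fun w hw => by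
    by_contra! hc
    exact h.swap13.alt hG hyR hyQ' hyQ hyP htP htS hw
      ⟨hne.symm, hty'.symm, hc.2.1.symm, hty.symm, hc.1.symm, hc.2.2.symm⟩
  have yR : y ∈ R := by simp [hR']
  have tR : t ∈ R := by simp [hR']
  have yS : y ∈ S := by simp [hS']
  have yS' : y' ∈ S := by simp [hS']
  have hP' : P = {y, y', t} := key P hP fun w hw => by
    by_contra! hc
    exact h.swap12.swap23.swap34.alt hG hyQ' hyR yR yS htS htP hw
      ⟨hne.symm, hty'.symm, hc.2.1.symm, hty.symm, hc.1.symm, hc.2.2.symm⟩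
  have hQ' : Q = {y, y', t} := key Q hQ fun w hw => by
    by_contra! hc
    exact h.swap23.swap34.alt hG htP tR yR yS yS' hyQ' hw
      ⟨hty, hty', hc.2.2.symm, hne, hc.1.symm, hc.2.1.symm⟩
  exact ⟨hP'.trans hR'.symm, hQ'.trans hR'.symm, hS'.trans hR'.symm⟩

lemma not_disjoint {A B : Finset V} (hA : 3 ≤ A.card) (hB : 3 ≤ B.card) (hAY : A ⊆ Y)
    (hBY : B ⊆ Y) (hY : Y.card ≤ 5) : ¬ Disjoint A B := fun h => by
  have := Finset.card_le_card (Finset.union_subset hAY hBY)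
  rw [Finset.card_union_of_disjoint h] at this
  omega

lemma eq_of_path_five (h : G.Quad Y p q r s P Q R S) (hG : G.P8Free) (hY : Y.card ≤ 5)
    (hP : 3 ≤ P.card) (hQ : 3 ≤ Q.card) (hR : 3 ≤ R.card) (hS : 3 ≤ S.card) {y y' : V}
    (hyP : y ∈ P) (hyQ : y ∈ Q) (hyQ' : y' ∈ Q) (hyR : y' ∈ R) (hne : y ≠ y') :
    P = R ∧ Q = R ∧ S = R := by
  by_cases hSP : ∀ t ∈ S, t ∈ P → t = y ∨ t = y'
  · by_cases hSR : ∀ t ∈ S, t ∈ R → t = y ∨ t = y'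
    · exfalso
      by_cases hz : ∃ z, z ∈ P ∧ z ∈ R ∧ z ≠ y ∧ z ≠ y'
      · obtain ⟨z, hzP, hzR, hzy, hzy'⟩ := hz
        obtain ⟨n1, n2⟩ :=
          h.disjoint_of_hexagon hG hS hyP hyQ hyQ' hyR hne hSP hzP hzR hzy hzy'
        exact not_disjoint hP hS h.sub.1 h.sub.2.2.2 hY <| Finset.disjoint_left.2
          fun t htP htS => by rcases hSP t htS htP with rfl | rfl <;> contradiction
      · push Not at hz
        exact (h.not_sunflower hG (k := 3) (by omega) (by omega) hP hQ hR hS hyP hyQ hyQ' hyR hne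
          hSP hSR fun t htP htR => or_iff_not_imp_left.2 fun h => hz t htP htR h).elim
    · push Not at hSR
      obtain ⟨t, htS, htR, hty, hty'⟩ := hSR
      obtain ⟨h1, h2, h3⟩ := h.swap13.eq_of_common hG hR hQ hP hS hyR hyQ' hyQ hyP hne.symm htS htR
        hty' hty
      exact ⟨h1.symm, h2.trans h1.symm, h3.trans h1.symm⟩
  · push Not at hSP
    obtain ⟨t, htS, htP, hty, hty'⟩ := hSP
    exact h.eq_of_common hG hP hQ hR hS hyP hyQ hyQ' hyR hne htS htP hty hty'

/-- Four vertices with three neighbours each in a set of at most five vertices have the same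
neighbours. -/
lemma eq_of_five (h : G.Quad Y p q r s P Q R S) (hG : G.P8Free) (hY : Y.card ≤ 5)
    (hP : 3 ≤ P.card) (hQ : 3 ≤ Q.card) (hR : 3 ≤ R.card) (hS : 3 ≤ S.card) : P = Q := by
  obtain ⟨sP, sQ, sR, sS⟩ := h.sub
  rcases path_or_disjoint hP hQ hR sP sQ sR (by omega) with ⟨y, y', e⟩ | ⟨y, y', e⟩ | ⟨y, y', e⟩ |
    e | e | e
  · obtain ⟨h1, h2, h3⟩ :=
      h.eq_of_path_five hG hY hP hQ hR hS e.2.1 e.2.2.1 e.2.2.2.1 e.2.2.2.2 e.1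
    exact h1.trans h2.symm
  · exact (h.swap23.eq_of_path_five hG hY hP hR hQ hS e.2.1 e.2.2.1 e.2.2.2.1 e.2.2.2.2 e.1).1
  · obtain ⟨h1, h2, h3⟩ :=
      h.swap12.eq_of_path_five hG hY hQ hP hR hS e.2.1 e.2.2.1 e.2.2.2.1 e.2.2.2.2 e.1
    exact h2.trans h1.symm
  · exact (not_disjoint hP hQ sP sQ hY e.1).elim
  · exact (not_disjoint hP hQ sP sQ hY e.1).elim
  · exact (not_disjoint hP hR sP sR hY e.1).elim

end Quad

end SimpleGraph

/-! ### Two colours between seven and seven, or six and eight, vertices. -/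

namespace SimpleGraph

variable {V : Type*}

lemma quad_filter {G : SimpleGraph V} {Y : Finset V} {p q r s : V}
    (hne : p ≠ q ∧ p ≠ r ∧ p ≠ s ∧ q ≠ r ∧ q ≠ s ∧ r ≠ s) (hp : p ∉ Y) (hq : q ∉ Y) (hr : r ∉ Y)
    (hs : s ∉ Y) : G.Quad Y p q r s (Y.filter (G.Adj p)) (Y.filter (G.Adj q))
      (Y.filter (G.Adj r)) (Y.filter (G.Adj s)) :=
  ⟨hne, ⟨hp, hq, hr, hs⟩, ⟨Finset.filter_subset _ _, Finset.filter_subset _ _,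
    Finset.filter_subset _ _, Finset.filter_subset _ _⟩, fun _ h => (Finset.mem_filter.1 h).2,
    fun _ h => (Finset.mem_filter.1 h).2, fun _ h => (Finset.mem_filter.1 h).2,
    fun _ h => (Finset.mem_filter.1 h).2⟩

lemma exists_two_more {A : Finset V} (hA : 4 ≤ A.card) {p q : V} (hp : p ∈ A) (hq : q ∈ A)
    (hpq : p ≠ q) : ∃ r ∈ A, ∃ s ∈ A, p ≠ q ∧ p ≠ r ∧ p ≠ s ∧ q ≠ r ∧ q ≠ s ∧ r ≠ s := by
  have h2 : 1 < ((A.erase p).erase q).card := by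
    rw [Finset.card_erase_of_mem (by simp [hq, hpq.symm]), Finset.card_erase_of_mem hp]
    omega
  obtain ⟨r, hr, s, hs, hrs⟩ := Finset.one_lt_card.1 h2
  simp only [Finset.mem_erase] at hr hs
  exact ⟨r, hr.2.2, s, hs.2.2, hpq, hr.2.1.symm, hs.2.1.symm, hr.1.symm, hs.1.symm, hrs⟩

lemma card_le_degIn_add {B G : SimpleGraph V} {Y : Finset V} {x : V}
    (h : ∀ y ∈ Y, B.Adj x y ∨ G.Adj x y) : Y.card ≤ B.degIn Y x + G.degIn Y x := by
  unfold degIn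
  refine le_trans (Finset.card_le_card fun y hy => ?_) (Finset.card_union_le _ _)
  simpa [hy] using h y hy

variable {B G : SimpleGraph V} {X Y : Finset V}

/-- Four vertices with at least four neighbours each in an eight-element set all have exactly
four, and the neighbourhoods of two of them are equal or complementary. -/
lemma P8Free.filter_eq_or (hB : B.P8Free) (hXY : Disjoint X Y) (hX : 4 ≤ X.card) (hY : Y.card ≤ 8)
    (hd : ∀ x ∈ X, 4 ≤ B.degIn Y x) {p q : V} (hp : p ∈ X) (hq : q ∈ X) :
    Y.filter (B.Adj p) = Y.filter (B.Adj q) ∨ Y.filter (B.Adj p) = Y \ Y.filter (B.Adj q) := by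
  by_cases hpq : p = q
  · exact .inl (by rw [hpq])
  obtain ⟨r, hr, s, hs, hne⟩ := exists_two_more hX hp hq hpq
  have hn := Finset.disjoint_left.1 hXY
  exact (quad_filter hne (hn hp) (hn hq) (hn hr) (hn hs)).eq_or_eq_sdiff hB hY (hd _ hp) (hd _ hq)
    (hd _ hr) (hd _ hs)

/-- Fewer than four vertices share the same large neighbourhood. -/
lemma P8Free.card_filter_lt (hB : B.P8Free) (hXY : Disjoint X Y) {A : Finset V} (hA : A ⊆ Y)
    (hA4 : 4 ≤ A.card) (h : ∀ x ∈ X, ∀ a ∈ A, B.Adj x a) : X.card ≤ 3 := by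
  by_contra! hX
  obtain ⟨a, ha, b, hb, hab⟩ := hB.not_complete_bipartite (A := X) hX hA4
    (hXY.mono_right hA)
  exact hab (h a ha b hb)

/-- Complementary neighbourhoods of size at least 4 need `|Y| = 8` and size exactly 4. Failing that,
all neighbourhoods coincide and `K_{4,4}` appears. -/
lemma P8Free.degIn_le_four (hB : B.P8Free) (hXY : Disjoint X Y) (hX : 4 ≤ X.card)
    (hY : Y.card ≤ 8) (hd : ∀ x ∈ X, 4 ≤ B.degIn Y x) {p : V} (hp : p ∈ X) :
    B.degIn Y p ≤ 4 ∧ Y.card = 8 := by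
  by_contra hcon
  have hall : ∀ q ∈ X, ∀ a ∈ Y.filter (B.Adj p), B.Adj q a := by
    intro q hq a ha
    rcases hB.filter_eq_or hXY hX hY hd hp hq with h | h
    · rw [h] at ha
      exact (Finset.mem_filter.1 ha).2
    · have h1 := congrArg Finset.card h
      rw [Finset.card_sdiff_of_subset (Finset.filter_subset _ _)] at h1
      have h2 := hd q hq
      have h3 := hd p hp
      unfold degIn at h2 h3 hcon
      omega
  have := hB.card_filter_lt hXY (Finset.filter_subset _ _) (hd p hp) hall
  omega

/-- A two-coloured `K_{7,7}` contains a monochromatic path on eight vertices. -/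
theorem P8Free.not_seven_seven (hB : B.P8Free) (hG : G.P8Free) (hXY : Disjoint X Y)
    (hX : X.card = 7) (hY : Y.card = 7) (h : ∀ x ∈ X, ∀ y ∈ Y, B.Adj x y ∨ G.Adj x y) : False := by
  have key : ∀ {B : SimpleGraph V}, B.P8Free → (X.filter fun x => 4 ≤ B.degIn Y x).card ≤ 3 := by
    intro B hB
    by_contra! h4
    obtain ⟨p, hp⟩ : (X.filter fun x => 4 ≤ B.degIn Y x).Nonempty := Finset.card_pos.1 (by omega)
    have := (hB.degIn_le_four (X := X.filter fun x => 4 ≤ B.degIn Y x)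
      (hXY.mono_left (Finset.filter_subset _ _)) h4 (by omega)
      (fun x hx => (Finset.mem_filter.1 hx).2) hp).2
    omega
  have h1 := key hB
  have h2 := key hG
  have h3 : X ⊆ (X.filter fun x => 4 ≤ B.degIn Y x) ∪ (X.filter fun x => 4 ≤ G.degIn Y x) := by
    intro x hx
    have := card_le_degIn_add (h x hx)
    simp only [Finset.mem_union, Finset.mem_filter, hx, true_and]
    omega
  have := (Finset.card_le_card h3).trans (Finset.card_union_le _ _)
  omega

/-- An edge hanging on the large side of a `K_{3,n}` creates a path on eight vertices. -/
lemma P8Free.not_adj_of_three_hubs (hB : B.P8Free) {X₁ C : Finset V} (hX : X₁.card = 3)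
    (hXC : Disjoint X₁ C) (h : ∀ x ∈ X₁, ∀ c ∈ C, B.Adj x c) {b v : V} (hb : b ∈ C) (hv : v ∉ X₁)
    (hC : 4 ≤ (C.erase v).card) : ¬ B.Adj v b := by
  intro hvb
  obtain ⟨x, y, z, hxy, hxz, hyz, rfl⟩ := Finset.card_eq_three.1 hX
  have hbv : b ∈ C.erase v := Finset.mem_erase.2 ⟨hvb.ne', hb⟩
  obtain ⟨c, d, e, hcd, hce, hde, hcde⟩ : ∃ c d e, c ≠ d ∧ c ≠ e ∧ d ≠ e ∧
      {c, d, e} ⊆ (C.erase v).erase b := by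
    obtain ⟨T, hT, hT3⟩ := Finset.exists_subset_card_eq
      (show 3 ≤ ((C.erase v).erase b).card by rw [Finset.card_erase_of_mem hbv]; omega)
    obtain ⟨c, d, e, h1, h2, h3, rfl⟩ := Finset.card_eq_three.1 hT3
    exact ⟨c, d, e, h1, h2, h3, hT⟩
  simp only [Finset.insert_subset_iff, Finset.singleton_subset_iff, Finset.mem_erase] at hcde
  obtain ⟨⟨cb, cv, hc⟩, ⟨db, dv, hd⟩, eb, ev, he⟩ := hcde
  have hx : x ∈ ({x, y, z} : Finset V) := by simp
  have hy : y ∈ ({x, y, z} : Finset V) := by simp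
  have hz : z ∈ ({x, y, z} : Finset V) := by simp
  have ne : ∀ {u w : V}, u ∈ ({x, y, z} : Finset V) → w ∈ C → u ≠ w := fun hu hw e =>
    Finset.disjoint_left.1 hXC hu (e ▸ hw)
  have nv : ∀ {u : V}, u ∈ ({x, y, z} : Finset V) → v ≠ u := fun hu e => hv (e ▸ hu)
  exact hB.elim (a := v) (b := b) (c := x) (d := c) (e := y) (f := d) (g := z) (k := e)
    ⟨hvb, (h _ hx _ hb).symm, h _ hx _ hc, (h _ hy _ hc).symm, h _ hy _ hd, (h _ hz _ hd).symm,
      h _ hz _ he⟩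
    ⟨nv hx, cv.symm, nv hy, dv.symm, nv hz, ev.symm, cb.symm, (ne hy hb).symm, db.symm,
      (ne hz hb).symm, eb.symm, hxy, ne hx hd, hxz, ne hx he, hcd, (ne hz hc).symm, hce, hyz,
      ne hy he, hde⟩

/-- The extremal two-colouring of `K_{6,8}` forces the third colour on the larger side. -/
lemma P8Free.not_three_three (hB : B.P8Free) (hG : G.P8Free) {R : SimpleGraph V} (hR : R.P8Free)
    {X₁ X₂ B₁ B₂ : Finset V} (h1 : X₁.card = 3) (h2 : X₂.card = 3) (hB₁ : 4 ≤ B₁.card)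
    (h8 : B₁.card + B₂.card = 8) (hd : Disjoint B₁ B₂) (hX₁ : Disjoint X₁ (B₁ ∪ B₂))
    (hX₂ : Disjoint X₂ (B₁ ∪ B₂)) (e1 : ∀ x ∈ X₁, ∀ y ∈ B₁, B.Adj x y)
    (e2 : ∀ x ∈ X₂, ∀ y ∈ B₁, G.Adj x y)
    (hc : ∀ u ∈ B₁ ∪ B₂, ∀ v ∈ B₁ ∪ B₂, u ≠ v → B.Adj u v ∨ G.Adj u v ∨ R.Adj u v) : False := by
  obtain ⟨T, hT, hT4⟩ := Finset.exists_subset_card_eq hB₁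
  have hTY : T ⊆ B₁ ∪ B₂ := hT.trans Finset.subset_union_left
  -- The third colour cannot be complete between two halves of the eight vertices; a pair of another
  -- colour hangs on a `K_{3,n}` of that colour.
  obtain ⟨b, hb, v, hv, hbv⟩ := hR.not_complete_bipartite (A := T) (B := (B₁ ∪ B₂) \ T) hT4.ge
    (by rw [Finset.card_sdiff_of_subset hTY, Finset.card_union_of_disjoint hd]; omega)
    Finset.disjoint_sdiff
  rw [Finset.mem_sdiff] at hv
  have hne : b ≠ v := fun e => hv.2 (e ▸ hb)
  have h4 : 4 ≤ (B₁.erase v).card := by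
    by_cases hvB : v ∈ B₁
    · have : T ⊂ B₁ := Finset.ssubset_iff_subset_ne.2 ⟨hT, fun e => hv.2 (e ▸ hvB)⟩
      have := Finset.card_lt_card this
      rw [Finset.card_erase_of_mem hvB]; omega
    · rwa [Finset.erase_eq_of_notMem hvB]
  have hd1 : Disjoint X₁ B₁ := hX₁.mono_right Finset.subset_union_left
  have hd2 : Disjoint X₂ B₁ := hX₂.mono_right Finset.subset_union_left
  rcases hc b (hTY hb) v hv.1 hne with h | h | h
  · exact hB.not_adj_of_three_hubs h1 hd1 e1 (hT hb)
      (fun hvX => Finset.disjoint_left.1 hX₁ hvX hv.1) h4 h.symm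
  · exact hG.not_adj_of_three_hubs h2 hd2 e2 (hT hb)
      (fun hvX => Finset.disjoint_left.1 hX₂ hvX hv.1) h4 h.symm
  · exact hbv h

/-- Three vertices with five neighbours each in an eight-element set: no path of length two can be
attached to one of them. -/
lemma P8Free.not_adj_of_five (hG : G.P8Free) {X₂ : Finset V} (h2 : X₂.card = 3) (hY : Y.card ≤ 8)
    (hXY : Disjoint X₂ Y) (hd : ∀ x ∈ X₂, 5 ≤ G.degIn Y x) {p s y : V} (hp : p ∉ X₂) (hpY : p ∉ Y)
    (hs : s ∈ X₂) (hy : y ∈ Y) (hpy : G.Adj p y) : ¬ G.Adj s y := by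
  intro hsy
  obtain ⟨t, u, hst, hsu, htu, hX⟩ : ∃ t u, s ≠ t ∧ s ≠ u ∧ t ≠ u ∧ X₂ = {s, t, u} := by
    obtain ⟨a, b, c, hab, hac, hbc, rfl⟩ := Finset.card_eq_three.1 h2
    simp only [Finset.mem_insert, Finset.mem_singleton] at hs
    rcases hs with rfl | rfl | rfl
    · exact ⟨b, c, hab, hac, hbc, rfl⟩
    · exact ⟨a, c, hab.symm, hbc, hac, by ext; simp; tauto⟩
    · exact ⟨a, b, hac.symm, hbc.symm, hab, by ext; simp; tauto⟩
  have ht : t ∈ X₂ := by simp [hX]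
  have hu : u ∈ X₂ := by simp [hX]
  have key : ∀ {t u y₁ y₂ : V}, t ∈ X₂ → u ∈ X₂ → s ≠ t → s ≠ u → t ≠ u →
      y₁ ∈ Y.filter (G.Adj s) → y₁ ∈ Y.filter (G.Adj t) → y₂ ∈ Y.filter (G.Adj t) →
      y₂ ∈ Y.filter (G.Adj u) → y ≠ y₁ → y ≠ y₂ → y₁ ≠ y₂ → False := by
    intro t u y₁ y₂ ht hu hst hsu htu h1 h1' h2 h2' n1 n2 n3
    obtain ⟨y₃, h3, h3'⟩ := exists_avoiding (S := Y.filter (G.Adj u)) [y, y₁, y₂]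
      (by have := hd u hu; unfold degIn at this; simp; omega)
    simp only [List.mem_cons, List.not_mem_nil, or_false, not_or] at h3'
    rw [Finset.mem_filter] at h1 h1' h2 h2' h3
    have ne : ∀ {a b : V}, a ∈ X₂ → b ∈ Y → a ≠ b := fun ha hb e =>
      Finset.disjoint_left.1 hXY ha (e ▸ hb)
    have pY : ∀ {b : V}, b ∈ Y → p ≠ b := fun hb e => hpY (e ▸ hb)
    have pX : ∀ {b : V}, b ∈ X₂ → p ≠ b := fun hb e => hp (e ▸ hb)
    exact hG.elim (a := p) (b := y) (c := s) (d := y₁) (e := t) (f := y₂) (g := u) (k := y₃)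
      ⟨hpy, hsy.symm, h1.2, h1'.2.symm, h2.2, h2'.2.symm, h3.2⟩
      ⟨pX hs, pY h1.1, pX ht, pY h2.1, pX hu, pY h3.1, n1, (ne ht hy).symm, n2, (ne hu hy).symm,
        Ne.symm h3'.1, hst, ne hs h2.1, hsu, ne hs h3.1, n3, (ne hu h1.1).symm, Ne.symm h3'.2.1,
        htu, ne ht h3.1, Ne.symm h3'.2.2⟩
  have hS := hd s hs
  have hT := hd t ht
  have hU := hd u hu
  unfold degIn at hS hT hU
  set S := Y.filter (G.Adj s) with hSdef
  set T := Y.filter (G.Adj t) with hTdef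
  set U := Y.filter (G.Adj u) with hUdef
  have hSY : S ⊆ Y := Finset.filter_subset _ _
  have hTY : T ⊆ Y := Finset.filter_subset _ _
  have hUY : U ⊆ Y := Finset.filter_subset _ _
  have inter : ∀ {S T : Finset V}, S ⊆ Y → T ⊆ Y → 5 ≤ S.card → 5 ≤ T.card → 2 ≤ (S ∩ T).card := by
    intro S T hS hT h1 h2
    have := Finset.card_le_card (Finset.union_subset hS hT)
    have := Finset.card_union_add_card_inter S T
    omega
  have iST := inter hSY hTY hS hT
  have iSU := inter hSY hUY hS hU
  have iTU := inter hTY hUY hT hU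
  -- The connectors `y₁`, `y₂` must avoid `y` and each other, so one intersection needs three
  -- elements. If `T ∩ U` has only two, then `T ∪ U = Y` and the five elements of `S` give three to
  -- `S ∩ T` or `S ∩ U`.
  by_cases hTU3 : 3 ≤ (T ∩ U).card
  · obtain ⟨y₁, h1, h1'⟩ := exists_avoiding (S := S ∩ T) [y] (by simp; omega)
    obtain ⟨y₂, h2, h2'⟩ := exists_avoiding (S := T ∩ U) [y, y₁] (by simp; omega)
    simp only [List.mem_cons, List.not_mem_nil, or_false, not_or, Finset.mem_inter] at *
    exact key ht hu hst hsu htu h1.1 h1.2 h2.1 h2.2 (Ne.symm h1') (Ne.symm h2'.1) (Ne.symm h2'.2)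
  · obtain ⟨y₂, h2, h2'⟩ := exists_avoiding (S := T ∩ U) [y] (by simp; omega)
    have hTUY : T ∪ U = Y := Finset.eq_of_subset_of_card_le (Finset.union_subset hTY hUY) (by
      have := Finset.card_union_add_card_inter T U
      omega)
    have h5 : 5 ≤ (S ∩ T).card + (S ∩ U).card := by
      have h6 : S ⊆ (S ∩ T) ∪ (S ∩ U) := by
        rw [← Finset.inter_union_distrib_left, hTUY]
        exact Finset.subset_inter subset_rfl hSY
      have := (Finset.card_le_card h6).trans (Finset.card_union_le _ _)
      omega
    have h6 : 3 ≤ (S ∩ T).card ∨ 3 ≤ (S ∩ U).card := by omega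
    rcases h6 with h6 | h6
    · obtain ⟨y₁, h1, h1'⟩ := exists_avoiding (S := S ∩ T) [y, y₂] (by simp; omega)
      simp only [List.mem_cons, List.not_mem_nil, or_false, not_or, Finset.mem_inter] at *
      exact key ht hu hst hsu htu h1.1 h1.2 h2.1 h2.2 (Ne.symm h1'.1) (Ne.symm h2') h1'.2
    · obtain ⟨y₁, h1, h1'⟩ := exists_avoiding (S := S ∩ U) [y, y₂] (by simp; omega)
      simp only [List.mem_cons, List.not_mem_nil, or_false, not_or, Finset.mem_inter] at *
      exact key hu ht hsu hst htu.symm h1.1 h1.2 h2.2 h2.1 (Ne.symm h1'.1) (Ne.symm h2') h1'.2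

end SimpleGraph

namespace SimpleGraph

variable {V : Type*} {B G R : SimpleGraph V} {X Y : Finset V}

/-- All `B`-neighbourhoods are a fixed four-set or its complement, each occurring at most three
times since `K_{4,4}` is excluded. This is the split treated in `P8Free.not_three_three`. -/
lemma P8Free.not_six_eight_of_four (hB : B.P8Free) (hG : G.P8Free) (hR : R.P8Free)
    (hXY : Disjoint X Y) (hX : X.card = 6) (hY : Y.card = 8)
    (h : ∀ x ∈ X, ∀ y ∈ Y, B.Adj x y ∨ G.Adj x y)
    (hc : ∀ u ∈ Y, ∀ v ∈ Y, u ≠ v → B.Adj u v ∨ G.Adj u v ∨ R.Adj u v)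
    (hd : ∀ x ∈ X, 4 ≤ B.degIn Y x) : False := by
  obtain ⟨x₀, hx₀⟩ : X.Nonempty := Finset.card_pos.1 (by omega)
  set A := Y.filter (B.Adj x₀) with hA
  have hAY : A ⊆ Y := Finset.filter_subset _ _
  have hA4 : A.card = 4 :=
    le_antisymm (hB.degIn_le_four hXY (by omega) hY.le hd hx₀).1 (hd _ hx₀)
  have hA4' : (Y \ A).card = 4 := by rw [Finset.card_sdiff_of_subset hAY]; omega
  set X₁ := X.filter fun x => Y.filter (B.Adj x) = A with hX₁
  set X₂ := X.filter fun x => ¬ Y.filter (B.Adj x) = A with hX₂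
  have hsum : X₁.card + X₂.card = 6 := by
    rw [hX₁, hX₂, Finset.card_filter_add_card_filter_not, hX]
  have hd1 : Disjoint X₁ Y := hXY.mono_left (Finset.filter_subset _ _)
  have hd2 : Disjoint X₂ Y := hXY.mono_left (Finset.filter_subset _ _)
  have e1 : ∀ x ∈ X₁, ∀ y ∈ A, B.Adj x y := fun x hx y hy => by
    rw [← (Finset.mem_filter.1 hx).2] at hy
    exact (Finset.mem_filter.1 hy).2
  have e2 : ∀ x ∈ X₂, Y.filter (B.Adj x) = Y \ A := fun x hx => by
    obtain ⟨hx, hne⟩ := Finset.mem_filter.1 hx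
    exact (hB.filter_eq_or hXY (by omega) hY.le hd hx hx₀).resolve_left hne
  have c1 := hB.card_filter_lt hd1 hAY hA4.ge e1
  have c2 := hB.card_filter_lt hd2 (A := Y \ A) Finset.sdiff_subset hA4'.ge fun x hx y hy => by
    rw [← e2 x hx] at hy
    exact (Finset.mem_filter.1 hy).2
  have hun : A ∪ (Y \ A) = Y := Finset.union_sdiff_of_subset hAY
  refine hB.not_three_three hG hR (X₁ := X₁) (X₂ := X₂) (B₁ := A) (B₂ := Y \ A) (by omega)
    (by omega) hA4.ge (by omega) Finset.disjoint_sdiff (by rwa [hun]) (by rwa [hun]) e1 ?_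
    (by rwa [hun])
  intro x hx y hy
  refine (h x (Finset.mem_filter.1 hx).1 y (hAY hy)).resolve_left fun hxy => ?_
  have : y ∈ Y.filter (B.Adj x) := Finset.mem_filter.2 ⟨hAY hy, hxy⟩
  rw [e2 x hx] at this
  exact (Finset.mem_sdiff.1 this).2 hy

/-- The vertices of `B`-degree at least 4 have it exactly 4, so every vertex of `X` has `G`-degree
at least 4. -/
lemma P8Free.not_six_eight_of_card (hB : B.P8Free) (hG : G.P8Free) (hR : R.P8Free)
    (hXY : Disjoint X Y) (hX : X.card = 6) (hY : Y.card = 8)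
    (h : ∀ x ∈ X, ∀ y ∈ Y, B.Adj x y ∨ G.Adj x y)
    (hc : ∀ u ∈ Y, ∀ v ∈ Y, u ≠ v → B.Adj u v ∨ G.Adj u v ∨ R.Adj u v)
    (h4 : 4 ≤ (X.filter fun x => 4 ≤ B.degIn Y x).card) : False := by
  have hg : ∀ x ∈ X, 4 ≤ G.degIn Y x := by
    intro x hx
    have h8 := card_le_degIn_add (h x hx)
    by_cases hxb : 4 ≤ B.degIn Y x
    · have := (hB.degIn_le_four (X := X.filter fun x => 4 ≤ B.degIn Y x)
        (hXY.mono_left (Finset.filter_subset _ _)) h4 hY.le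
        (fun x hx => (Finset.mem_filter.1 hx).2) (p := x) (by simp [hx, hxb])).1
      omega
    · omega
  exact hG.not_six_eight_of_four hB hR hXY hX hY (fun x hx y hy => (h x hx y hy).symm)
    (fun u hu v hv huv => by have := hc u hu v hv huv; tauto) hg

/-- In a three-coloured `K_14` without monochromatic `P_8`, no colour is absent between a set of
six vertices and the remaining eight. -/
theorem P8Free.not_six_eight (hB : B.P8Free) (hG : G.P8Free) (hR : R.P8Free)
    (hXY : Disjoint X Y) (hX : X.card = 6) (hY : Y.card = 8)
    (h : ∀ x ∈ X, ∀ y ∈ Y, B.Adj x y ∨ G.Adj x y)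
    (hc : ∀ u ∈ Y, ∀ v ∈ Y, u ≠ v → B.Adj u v ∨ G.Adj u v ∨ R.Adj u v) : False := by
  have h' : ∀ x ∈ X, ∀ y ∈ Y, G.Adj x y ∨ B.Adj x y := fun x hx y hy => (h x hx y hy).symm
  have hc' : ∀ u ∈ Y, ∀ v ∈ Y, u ≠ v → G.Adj u v ∨ B.Adj u v ∨ R.Adj u v :=
    fun u hu v hv huv => by have := hc u hu v hv huv; tauto
  by_cases hb : 4 ≤ (X.filter fun x => 4 ≤ B.degIn Y x).card
  · exact hB.not_six_eight_of_card hG hR hXY hX hY h hc hb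
  by_cases hg : 4 ≤ (X.filter fun x => 4 ≤ G.degIn Y x).card
  · exact hG.not_six_eight_of_card hB hR hXY hX hY h' hc' hg
  set Xb := X.filter fun x => 4 ≤ B.degIn Y x with hXb
  set Xg := X.filter fun x => 4 ≤ G.degIn Y x with hXg
  have hbX : Xb ⊆ X := Finset.filter_subset _ _
  have hgX : Xg ⊆ X := Finset.filter_subset _ _
  have hcov : X ⊆ Xb ∪ Xg := by
    intro x hx
    have := card_le_degIn_add (h x hx)
    simp only [hXb, hXg, Finset.mem_union, Finset.mem_filter, hx, true_and]
    omega
  have h6 := Finset.card_le_card hcov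
  have hui := Finset.card_union_add_card_inter Xb Xg
  have hdis : Disjoint Xb Xg := by
    rw [Finset.disjoint_iff_inter_eq_empty, ← Finset.card_eq_zero]
    omega
  have hb3 : Xb.card = 3 := by omega
  have hg3 : Xg.card = 3 := by omega
  have hdb : ∀ x ∈ Xb, 5 ≤ B.degIn Y x := by
    intro x hx
    have := card_le_degIn_add (h x (hbX hx))
    have : ¬ 4 ≤ G.degIn Y x := fun h4 =>
      Finset.disjoint_left.1 hdis hx (Finset.mem_filter.2 ⟨hbX hx, h4⟩)
    omega
  have hdg : ∀ x ∈ Xg, 5 ≤ G.degIn Y x := by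
    intro x hx
    have := card_le_degIn_add (h x (hgX hx))
    have : ¬ 4 ≤ B.degIn Y x := fun h4 =>
      Finset.disjoint_left.1 hdis (Finset.mem_filter.2 ⟨hgX hx, h4⟩) hx
    omega
  have hXbY : Disjoint Xb Y := hXY.mono_left hbX
  have hXgY : Disjoint Xg Y := hXY.mono_left hgX
  have nB : ∀ p ∈ Xb, ∀ s ∈ Xg, ∀ y ∈ Y, B.Adj s y → ¬ B.Adj p y := fun p hp s hs y hy hsy =>
    hB.not_adj_of_five hb3 hY.le hXbY hdb (fun h => Finset.disjoint_left.1 hdis h hs)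
      (Finset.disjoint_left.1 hXgY hs) hp hy hsy
  have nG : ∀ p ∈ Xb, ∀ s ∈ Xg, ∀ y ∈ Y, G.Adj p y → ¬ G.Adj s y := fun p hp s hs y hy hpy =>
    hG.not_adj_of_five hg3 hY.le hXgY hdg (fun h => Finset.disjoint_left.1 hdis hp h)
      (Finset.disjoint_left.1 hXbY hp) hs hy hpy
  -- By `nB` and `nG`, each vertex of `Y` is joined to `Xb` in one colour and to `Xg` in the other.
  -- The larger part of the resulting partition of `Y` has at least four vertices.
  set B₁ := Y.filter fun y => ∀ p ∈ Xb, ¬ G.Adj p y with hB₁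
  have hB₁Y : B₁ ⊆ Y := Finset.filter_subset _ _
  obtain ⟨p₀, hp₀⟩ : Xb.Nonempty := Finset.card_pos.1 (by omega)
  obtain ⟨s₀, hs₀⟩ : Xg.Nonempty := Finset.card_pos.1 (by omega)
  have e1 : ∀ p ∈ Xb, ∀ y ∈ B₁, B.Adj p y := fun p hp y hy =>
    (h p (hbX hp) y (hB₁Y hy)).resolve_right ((Finset.mem_filter.1 hy).2 p hp)
  have e2 : ∀ s ∈ Xg, ∀ y ∈ B₁, G.Adj s y := fun s hs y hy =>
    (h s (hgX hs) y (hB₁Y hy)).resolve_left fun hsy =>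
      nB p₀ hp₀ s hs y (hB₁Y hy) hsy (e1 p₀ hp₀ y hy)
  have e3 : ∀ s ∈ Xg, ∀ y ∈ Y \ B₁, B.Adj s y := fun s hs y hy => by
    obtain ⟨hyY, hy⟩ := Finset.mem_sdiff.1 hy
    simp only [hB₁, Finset.mem_filter, hyY, true_and] at hy
    push Not at hy
    obtain ⟨p, hp, hpy⟩ := hy
    exact (h s (hgX hs) y hyY).resolve_right (nG p hp s hs y hyY hpy)
  have e4 : ∀ p ∈ Xb, ∀ y ∈ Y \ B₁, G.Adj p y := fun p hp y hy =>
    have hyY := (Finset.mem_sdiff.1 hy).1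
    (h p (hbX hp) y hyY).resolve_left (nB p hp s₀ hs₀ y hyY (e3 s₀ hs₀ y hy))
  have hun : B₁ ∪ (Y \ B₁) = Y := Finset.union_sdiff_of_subset hB₁Y
  have hun' : (Y \ B₁) ∪ B₁ = Y := Finset.sdiff_union_of_subset hB₁Y
  have hcard : (Y \ B₁).card = Y.card - B₁.card := Finset.card_sdiff_of_subset hB₁Y
  have hle := Finset.card_le_card hB₁Y
  by_cases h4 : 4 ≤ B₁.card
  · exact hB.not_three_three hG hR hb3 hg3 (B₂ := Y \ B₁) h4 (by omega) Finset.disjoint_sdiff (by rwa [hun])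
      (by rwa [hun]) e1 e2 (by rwa [hun])
  · exact hB.not_three_three hG hR hg3 hb3 (B₁ := Y \ B₁) (B₂ := B₁) (by omega) (by omega)
      Finset.sdiff_disjoint (by rwa [hun']) (by rwa [hun']) e3 e4 (by rwa [hun'])

/-! ### Two colours between five and nine vertices. -/

/-- The vertices of `Wb` share exactly three `B`-neighbours in `F`. This `K_{3,n}` forbids `B`-edges
at `Wb` inside `Q`, so `G` contains those edges and all edges from `Wb` to the two other vertices of
`F`, enough for a `G`-path on eight vertices. -/
lemma P8Free.not_nine_five_of_card (hB : B.P8Free) (hG : G.P8Free) {F W Q : Finset V}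
    (hF : F.card = 5) (hQ : Q.card = 6) (hW : W.card = 9) (hQW : Q ⊆ W)
    (hFW : Disjoint F W) (h : ∀ f ∈ F, ∀ w ∈ W, B.Adj w f ∨ G.Adj w f)
    (hQQ : ∀ u ∈ Q, ∀ v ∈ Q, u ≠ v → B.Adj u v ∨ G.Adj u v)
    (h5 : 5 ≤ (W.filter fun w => 3 ≤ B.degIn F w).card) : False := by
  set Wb := W.filter fun w => 3 ≤ B.degIn F w with hWb
  have hbW : Wb ⊆ W := Finset.filter_subset _ _
  have hFb : Disjoint F Wb := hFW.mono_right hbW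
  have hnF : ∀ {w}, w ∈ W → w ∉ F := fun hw hF => Finset.disjoint_left.1 hFW hF hw
  obtain ⟨w₀, hw₀⟩ : Wb.Nonempty := Finset.card_pos.1 (by omega)
  have hdb : ∀ w ∈ Wb, 3 ≤ (F.filter (B.Adj w)).card := fun w hw => (Finset.mem_filter.1 hw).2
  have hsame : ∀ w ∈ Wb, F.filter (B.Adj w) = F.filter (B.Adj w₀) := by
    intro w hw
    by_cases hww : w = w₀
    · rw [hww]
    obtain ⟨r, hr, s, hs, hne⟩ := exists_two_more (by omega) hw hw₀ hww
    exact (quad_filter hne (hnF (hbW hw)) (hnF (hbW hw₀)) (hnF (hbW hr))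
      (hnF (hbW hs))).eq_of_five hB hF.le (hdb _ hw) (hdb _ hw₀) (hdb _ hr) (hdb _ hs)
  set F₁ := F.filter (B.Adj w₀) with hF₁
  have hF₁F : F₁ ⊆ F := Finset.filter_subset _ _
  have e1 : ∀ w ∈ Wb, ∀ f ∈ F₁, B.Adj w f := fun w hw f hf => by
    rw [← hsame w hw] at hf
    exact (Finset.mem_filter.1 hf).2
  have hF₁3 : F₁.card = 3 := by
    refine le_antisymm ?_ (hdb w₀ hw₀)
    by_contra! h4
    have := hB.card_filter_lt (X := Wb) (Y := F) hFb.symm hF₁F h4 e1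
    omega
  obtain ⟨f, f', hff, hF₂⟩ := Finset.card_eq_two.1
    (show (F \ F₁).card = 2 by rw [Finset.card_sdiff_of_subset hF₁F]; omega)
  have hf : f ∈ F \ F₁ := by simp [hF₂]
  have hf' : f' ∈ F \ F₁ := by simp [hF₂]
  have e2 : ∀ w ∈ Wb, ∀ f ∈ F \ F₁, G.Adj w f := fun w hw f hf => by
    obtain ⟨hfF, hf⟩ := Finset.mem_sdiff.1 hf
    refine (h f hfF w (hbW hw)).resolve_left fun hwf => hf ?_
    rw [← hsame w hw]
    exact Finset.mem_filter.2 ⟨hfF, hwf⟩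
  have e3 : ∀ b ∈ Wb, b ∈ Q → ∀ v ∈ Q, v ≠ b → G.Adj v b := fun b hb hbQ v hv hvb => by
    refine (hQQ v hv b hbQ hvb).resolve_left (hB.not_adj_of_three_hubs hF₁3
      (hFb.mono_left hF₁F) (fun x hx c hc => (e1 c hc x hx).symm) hb
      (fun hvF => hnF (hQW hv) (hF₁F hvF)) ?_)
    have := Finset.pred_card_le_card_erase (s := Wb) (a := v)
    omega
  have neF : ∀ {w g}, w ∈ W → g ∈ F \ F₁ → w ≠ g := fun hw hg e =>
    hnF hw (e ▸ (Finset.mem_sdiff.1 hg).1)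
  have hi := Finset.card_union_add_card_inter Wb Q
  have hu := Finset.card_le_card (Finset.union_subset hbW hQW)
  have hQb : (Q \ Wb).card + (Wb ∩ Q).card = 6 := by
    rw [Finset.inter_comm, Finset.card_sdiff_add_card_inter, hQ]
  by_cases hq : 5 ≤ (Wb ∩ Q).card
  · obtain ⟨a, ha, b, hb, c, hc, d, hd, hab, hac, had, hbc, hbd, hcd⟩ :=
      exists_four (show 4 ≤ (Wb ∩ Q).card by omega)
    obtain ⟨e, he, hne⟩ := exists_avoiding (S := Wb ∩ Q) [a, b, c, d] (by simp; omega)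
    obtain ⟨x, hx, hxne⟩ := exists_avoiding (S := Q) [a, b, c, d, e] (by simp; omega)
    simp only [List.mem_cons, List.not_mem_nil, or_false, not_or, Finset.mem_inter] at *
    refine hG.elim (a := x) (b := a) (c := b) (d := f) (e := c) (f := f') (g := d) (k := e)
      ⟨e3 _ ha.1 ha.2 _ hx hxne.1, e3 _ hb.1 hb.2 _ ha.2 hab, e2 _ hb.1 _ hf,
        (e2 _ hc.1 _ hf).symm, e2 _ hc.1 _ hf', (e2 _ hd.1 _ hf').symm,
        e3 _ he.1 he.2 _ hd.2 (Ne.symm hne.2.2.2)⟩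
      ⟨hxne.2.1, neF (hQW hx) hf, hxne.2.2.1, neF (hQW hx) hf', hxne.2.2.2.1, hxne.2.2.2.2,
        neF (hQW ha.2) hf, hac, neF (hQW ha.2) hf', had, Ne.symm hne.1, hbc, neF (hQW hb.2) hf', hbd,
        Ne.symm hne.2.1, hff, (neF (hQW hd.2) hf).symm, (neF (hQW he.2) hf).symm, hcd,
        Ne.symm hne.2.2.1, (neF (hQW he.2) hf').symm⟩
  -- Since `5 + 6 - 9 = 2`, `Wb ∩ Q` has at least two elements; having at most four, it leaves at
  -- least two in `Q \ Wb`.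
  · obtain ⟨a, ha, b, hb, hab⟩ := Finset.one_lt_card.1 (show 1 < (Wb ∩ Q).card by omega)
    obtain ⟨d, hd, d', hd', hdd⟩ := Finset.one_lt_card.1 (show 1 < (Q \ Wb).card by omega)
    rw [Finset.mem_inter] at ha hb
    rw [Finset.mem_sdiff] at hd hd'
    obtain ⟨x, hx, hxne⟩ := exists_avoiding (S := Wb) [a, b] (by simp; omega)
    obtain ⟨y, hy, hyne⟩ := exists_avoiding (S := Wb) [a, b, x] (by simp; omega)
    simp only [List.mem_cons, List.not_mem_nil, or_false, not_or] at hxne hyne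
    have nd : ∀ {u v}, u ∈ Wb → v ∉ Wb → u ≠ v := fun hu hv e => hv (e ▸ hu)
    exact hG.elim (a := x) (b := f) (c := y) (d := f') (e := a) (f := d) (g := b) (k := d')
      ⟨e2 _ hx _ hf, (e2 _ hy _ hf).symm, e2 _ hy _ hf', (e2 _ ha.1 _ hf').symm,
        (e3 _ ha.1 ha.2 _ hd.1 (nd ha.1 hd.2).symm).symm, e3 _ hb.1 hb.2 _ hd.1 (nd hb.1 hd.2).symm,
        (e3 _ hb.1 hb.2 _ hd'.1 (nd hb.1 hd'.2).symm).symm⟩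
      ⟨Ne.symm hyne.2.2, neF (hbW hx) hf', hxne.1, nd hx hd.2, hxne.2, nd hx hd'.2, hff,
        (neF (hbW ha.1) hf).symm, (neF (hQW hd.1) hf).symm, (neF (hbW hb.1) hf).symm,
        (neF (hQW hd'.1) hf).symm, hyne.1, nd hy hd.2, hyne.2.1, nd hy hd'.2,
        (neF (hQW hd.1) hf').symm, (neF (hbW hb.1) hf').symm, (neF (hQW hd'.1) hf').symm, hab,
        nd ha.1 hd'.2, hdd⟩

/-- Two colours between five and nine vertices, six of which form a two-coloured clique. -/
theorem P8Free.not_nine_five (hB : B.P8Free) (hG : G.P8Free) {F W Q : Finset V}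
    (hF : F.card = 5) (hQ : Q.card = 6) (hW : W.card = 9) (hQW : Q ⊆ W)
    (hFW : Disjoint F W) (h : ∀ f ∈ F, ∀ w ∈ W, B.Adj w f ∨ G.Adj w f)
    (hQQ : ∀ u ∈ Q, ∀ v ∈ Q, u ≠ v → B.Adj u v ∨ G.Adj u v) : False := by
  by_cases hb : 5 ≤ (W.filter fun w => 3 ≤ B.degIn F w).card
  · exact hB.not_nine_five_of_card hG hF hQ hW hQW hFW h hQQ hb
  refine hG.not_nine_five_of_card hB hF hQ hW hQW hFW (fun f hf w hw => (h f hf w hw).symm)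
    (fun u hu v hv huv => (hQQ u hu v hv huv).symm) ?_
  have hcov : W ⊆ (W.filter fun w => 3 ≤ B.degIn F w) ∪ (W.filter fun w => 3 ≤ G.degIn F w) := by
    intro w hw
    have := card_le_degIn_add fun f hf => h f hf w hw
    simp only [Finset.mem_union, Finset.mem_filter, hw, true_and]
    omega
  have := (Finset.card_le_card hcov).trans (Finset.card_union_le _ _)
  omega

end SimpleGraph

/-! ### Assembly: `K_11` minus an edge, then `K_14`. -/

namespace SimpleGraph

variable {V : Type*} {B G R : SimpleGraph V}

lemma ClosedIn.trans {K A A' : Finset V} (hA : G.ClosedIn K A) (hA'A : A' ⊆ A)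
    (h : G.ClosedIn A A') : G.ClosedIn K A' := fun a ha b hb hb' hab => by
  by_cases hbA : b ∈ A
  · exact h a ha b hbA hb' hab
  · exact hA a (hA'A ha) b hb hbA hab

/-- A smallest closed set with at least `n` vertices: each proper closed part is smaller than `n`. -/
lemma exists_min_closedIn (G : SimpleGraph V) {W : Finset V} {n : ℕ} (hn : n ≤ W.card) :
    ∃ Z ⊆ W, G.ClosedIn W Z ∧ n ≤ Z.card ∧
      ∀ A ⊆ Z, A ≠ Z → G.ClosedIn Z A → A.card < n := by
  obtain ⟨Z, hZ, hmin⟩ := Finset.exists_min_image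
    (W.powerset.filter fun Z => G.ClosedIn W Z ∧ n ≤ Z.card) Finset.card
    ⟨W, by simp only [Finset.mem_filter, Finset.mem_powerset, subset_rfl, true_and]
           exact ⟨fun a _ b hb hb' => (hb' hb).elim, hn⟩⟩
  simp only [Finset.mem_filter, Finset.mem_powerset] at hZ hmin
  refine ⟨Z, hZ.1, hZ.2.1, hZ.2.2, fun A hA hne hcl => ?_⟩
  by_contra! hAn
  have := hmin A ⟨hA.trans hZ.1, hZ.2.1.trans hA hcl, hAn⟩
  exact hne (Finset.eq_of_subset_of_card_le hA this)

lemma card_mul_le_degSum_add {W : Finset V}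
    (h : ∀ u ∈ W, ∀ v ∈ W, u ≠ v → B.Adj u v ∨ G.Adj u v ∨ R.Adj u v) :
    W.card * (W.card - 1) ≤ B.degSum W + G.degSum W + R.degSum W := by
  unfold degSum
  rw [← Finset.sum_add_distrib, ← Finset.sum_add_distrib, ← smul_eq_mul]
  refine Finset.card_nsmul_le_sum _ _ _ fun u hu => ?_
  rw [← Finset.card_erase_of_mem hu]
  unfold degIn
  refine le_trans (Finset.card_le_card (t := (W.filter (B.Adj u) ∪ W.filter (G.Adj u)) ∪
    W.filter (R.Adj u)) fun v hv => ?_) ((Finset.card_union_le _ _).trans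
    (Nat.add_le_add_right (Finset.card_union_le _ _) _))
  rw [Finset.mem_erase] at hv
  have := h u hu v hv.2 hv.1.symm
  simp only [Finset.mem_union, Finset.mem_filter, hv.2, true_and]
  tauto

/-- `K_{a,b}` minus an edge contains a path on eight vertices if `a, b ≥ 4` and `a + b ≥ 9`. -/
lemma P8Free.not_bipartite_sub_edge (hG : G.P8Free) {A C : Finset V} {x y : V} (hA : 4 ≤ A.card)
    (hC : 4 ≤ C.card) (hAC : 9 ≤ A.card + C.card) (hd : Disjoint A C)
    (h : ∀ a ∈ A, ∀ c ∈ C, G.Adj a c ∨ (a = x ∧ c = y) ∨ (a = y ∧ c = x)) : False := by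
  have key : ∀ {A C : Finset V}, 5 ≤ A.card → 4 ≤ C.card → Disjoint A C →
      (∀ a ∈ A, ∀ c ∈ C, G.Adj a c ∨ (a = x ∧ c = y) ∨ (a = y ∧ c = x)) → False := by
    intro A C hA hC hd h
    -- Deleting from the larger side an end of the missing edge leaves a `K_{4,4}`.
    obtain ⟨z, hz⟩ : ∃ z, ∀ a ∈ A.erase z, ∀ c ∈ C, G.Adj a c := by
      by_cases hx : x ∈ A
      · refine ⟨x, fun a ha c hc => ?_⟩
        rw [Finset.mem_erase] at ha
        rcases h a ha.2 c hc with h | ⟨rfl, -⟩ | ⟨-, rfl⟩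
        · exact h
        · exact (ha.1 rfl).elim
        · exact (Finset.disjoint_left.1 hd hx hc).elim
      · refine ⟨y, fun a ha c hc => ?_⟩
        rw [Finset.mem_erase] at ha
        rcases h a ha.2 c hc with h | ⟨rfl, -⟩ | ⟨rfl, -⟩
        · exact h
        · exact (hx ha.2).elim
        · exact (ha.1 rfl).elim
    obtain ⟨a, ha, c, hc, hac⟩ := hG.not_complete_bipartite (A := A.erase z) (B := C)
      (by have := Finset.pred_card_le_card_erase (s := A) (a := z); omega) hC
      (hd.mono_left (Finset.erase_subset _ _))
    exact hac (hz a ha c hc)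
  by_cases h5 : 5 ≤ A.card
  · exact key h5 hC hd h
  · refine key (A := C) (C := A) (by omega) hA hd.symm fun c hc a ha => ?_
    rcases h a ha c hc with h | h | h
    · exact .inl h.symm
    · exact .inr (.inr h.symm)
    · exact .inr (.inl h.symm)

/-- The bound 54 equals `6 * 11 - 12`, so a three-vertex cover must cover all of `W`. The other
eight vertices then have only colour `G`, apart from the missing edge, and contain `K_{4,4}`. -/
lemma P8Free.not_eleven_of_degSum (hB : B.P8Free) (hG : G.P8Free) {W : Finset V} {x y : V}
    (hW : W.card = 11) (h : ∀ u ∈ W, ∀ v ∈ W, u ≠ v →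
      B.Adj u v ∨ G.Adj u v ∨ (u = x ∧ v = y) ∨ (u = y ∧ v = x))
    (hD : 54 ≤ B.degSum W) : False := by
  obtain ⟨Z, hZW, hcl, h8, hmin⟩ := exists_min_closedIn B (W := W) (n := 8) (by omega)
  have hsmall : ∀ A ⊆ Z, A ≠ Z → B.ClosedIn Z A → A.card ≤ 3 := by
    intro A hA hne hAcl
    have h1 := hmin A hA hne hAcl
    have hAW := hA.trans hZW
    have hAcl' := hcl.trans hA hAcl
    by_contra! h4
    have hcard : (W \ A).card = W.card - A.card := Finset.card_sdiff_of_subset hAW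
    refine hG.not_bipartite_sub_edge (x := x) (y := y) (A := A) (C := W \ A) h4 (by omega)
      (by omega) Finset.disjoint_sdiff fun a ha c hc => ?_
    rw [Finset.mem_sdiff] at hc
    exact (h a (hAW ha) c hc.1 fun e => hc.2 (e ▸ ha)).resolve_left (hAcl' a ha c hc.1 hc.2)
  have hZ : B.ConnOn Z := by
    intro A hA hne hAZ hAcl
    have h1 := hsmall A hA hAZ hAcl
    have h2 := hsmall (Z \ A) Finset.sdiff_subset (fun e => by
      obtain ⟨a, ha⟩ := hne
      have := hA ha
      rw [← e] at this
      exact (Finset.mem_sdiff.1 this).2 ha) hAcl.compl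
    rw [Finset.card_sdiff_of_subset hA] at h2
    omega
  have hsum := hcl.degSum_eq hZW
  have hle := degSum_le (G := B) (W \ Z)
  have hZc := Finset.card_le_card hZW
  rw [Finset.card_sdiff_of_subset hZW, hW] at hle
  have hlow : 4 * Z.card + 6 ≤ B.degSum Z := by
    generalize hs : Z.card = s at *
    have : s ≤ 11 := by omega
    interval_cases s <;> omega
  obtain ⟨H, hHZ, hH3, hcov⟩ := hB.exists_cover hZ h8 hlow
  have hup := degSum_le_of_cover hHZ hH3 hcov
  have hZ11 : Z.card = 11 := by
    generalize hs : Z.card = s at *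
    have : s ≤ 11 := by omega
    interval_cases s <;> omega
  have hZeq : Z = W := Finset.eq_of_subset_of_card_le hZW (by omega)
  subst hZeq
  have hU : (Z \ H).card = 8 := by rw [Finset.card_sdiff_of_subset hHZ]; omega
  -- Both ends of the missing edge, as far as they lie in `Z \ H`, go to the same half.
  obtain ⟨A, hsA, hAU, hA⟩ := Finset.exists_subsuperset_card_eq (s := (Z \ H) ∩ {x, y})
    (t := Z \ H) (n := 4) Finset.inter_subset_left
    ((Finset.card_le_card Finset.inter_subset_right).trans (Finset.card_le_two.trans (by omega)))
    (by omega)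
  obtain ⟨a, ha, c, hc, hac⟩ := hG.not_complete_bipartite (A := A) (B := (Z \ H) \ A) hA.ge
    (by rw [Finset.card_sdiff_of_subset hAU]; omega) Finset.disjoint_sdiff
  have ha' := Finset.mem_sdiff.1 (hAU ha)
  rw [Finset.mem_sdiff] at hc
  have hc' := Finset.mem_sdiff.1 hc.1
  have hcxy : c ≠ x ∧ c ≠ y := by
    constructor <;> rintro rfl <;> exact hc.2 (hsA (by simp [hc'.1, hc'.2]))
  rcases h a ha'.1 c hc'.1 (fun e => hc.2 (e ▸ ha)) with h | h | h | h
  · rcases hcov a ha'.1 c hc'.1 h with h | h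
    exacts [ha'.2 h, hc'.2 h]
  · exact hac h
  · exact hcxy.2 h.2
  · exact hcxy.1 h.2

/-- A two-coloured `K_11` minus an edge contains a monochromatic path on eight vertices. -/
theorem P8Free.not_eleven (hB : B.P8Free) (hG : G.P8Free) {W : Finset V} {x y : V}
    (hW : W.card = 11) (h : ∀ u ∈ W, ∀ v ∈ W, u ≠ v →
      B.Adj u v ∨ G.Adj u v ∨ (u = x ∧ v = y) ∨ (u = y ∧ v = x)) : False := by
  -- The missing edge plays the third colour, leaving a degree sum of at least `110 - 2 = 2 * 54` to
  -- the two others.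
  have h1 := card_mul_le_degSum_add (B := B) (G := G) (R := fromEdgeSet {s(x, y)}) (W := W)
    fun u hu v hv huv => by
      have := h u hu v hv huv
      simp only [fromEdgeSet_adj, Set.mem_singleton_iff, Sym2.eq_iff]
      tauto
  have h2 : (fromEdgeSet {s(x, y)}).degSum W ≤ 2 := by
    have : ∀ v ∈ W, (fromEdgeSet {s(x, y)}).degIn W v ≤ if v ∈ ({x, y} : Finset V) then 1 else 0 := by
      intro v _
      split_ifs with hv
      · simp only [Finset.mem_insert, Finset.mem_singleton] at hv
        rcases hv with rfl | rfl
        · exact degIn_le_length [y] fun w _ hw => by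
            simp only [fromEdgeSet_adj, Set.mem_singleton_iff, Sym2.eq_iff] at hw
            simp only [List.mem_singleton]; grind
        · exact degIn_le_length [x] fun w _ hw => by
            simp only [fromEdgeSet_adj, Set.mem_singleton_iff, Sym2.eq_iff] at hw
            simp only [List.mem_singleton]; grind
      · exact (degIn_eq_zero fun w _ hw => hv (by
          simp only [fromEdgeSet_adj, Set.mem_singleton_iff, Sym2.eq_iff] at hw
          simp only [Finset.mem_insert, Finset.mem_singleton]; tauto)).le
    refine (Finset.sum_le_sum this).trans ?_
    rw [← Finset.sum_filter, Finset.sum_const, smul_eq_mul, mul_one]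
    refine (Finset.card_le_card (t := {x, y}) fun v hv => (Finset.mem_filter.1 hv).2).trans
      Finset.card_le_two
  rw [hW] at h1
  by_cases h3 : 54 ≤ B.degSum W
  · exact hB.not_eleven_of_degSum hG hW h h3
  · exact hG.not_eleven_of_degSum hB hW (fun u hu v hv huv => by
      have := h u hu v hv huv; tauto) (by omega)

lemma P8Free.not_fourteen_of_degSum (hR : R.P8Free) (hB : B.P8Free) (hG : G.P8Free)
    {W : Finset V} (hW : W.card = 14)
    (h : ∀ u ∈ W, ∀ v ∈ W, u ≠ v → R.Adj u v ∨ B.Adj u v ∨ G.Adj u v)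
    (hD : 61 ≤ R.degSum W) : False := by
  -- The parity gain is needed: the covering theorem asks for `4 * 14 + 6 = 62` when `Z = W`.
  have hD' : 62 ≤ R.degSum W := by
    obtain ⟨k, hk⟩ := even_degSum (G := R) W
    omega
  have hclosed : ∀ A ⊆ W, R.ClosedIn W A → A.card ≤ 5 ∨ 9 ≤ A.card := by
    intro A hA hcl
    have hcard : (W \ A).card = W.card - A.card := Finset.card_sdiff_of_subset hA
    have hbg : ∀ a ∈ A, ∀ c ∈ W \ A, B.Adj a c ∨ G.Adj a c := fun a ha c hc => by
      rw [Finset.mem_sdiff] at hc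
      exact (h a (hA ha) c hc.1 fun e => hc.2 (e ▸ ha)).resolve_left (hcl a ha c hc.1 hc.2)
    have hbg' : ∀ c ∈ W \ A, ∀ a ∈ A, B.Adj c a ∨ G.Adj c a := fun c hc a ha =>
      (hbg a ha c hc).imp (·.symm) (·.symm)
    have hc3 : ∀ {u v}, u ∈ W → v ∈ W → u ≠ v → B.Adj u v ∨ G.Adj u v ∨ R.Adj u v :=
      fun hu hv huv => by have := h _ hu _ hv huv; tauto
    by_contra! hcon
    obtain h6 | h7 | h8 : A.card = 6 ∨ A.card = 7 ∨ A.card = 8 := by omega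
    · exact hB.not_six_eight hG hR Finset.disjoint_sdiff h6 (by omega) hbg
        fun u hu v hv => hc3 (Finset.mem_sdiff.1 hu).1 (Finset.mem_sdiff.1 hv).1
    · exact hB.not_seven_seven hG Finset.disjoint_sdiff h7 (by omega) hbg
    · exact hB.not_six_eight hG hR Finset.sdiff_disjoint (by omega) h8 hbg'
        fun u hu v hv => hc3 (hA hu) (hA hv)
  obtain ⟨Z, hZW, hcl, h9, hmin⟩ := exists_min_closedIn R (W := W) (n := 9) (by omega)
  have hsum := hcl.degSum_eq hZW
  have hle := degSum_le (G := R) (W \ Z)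
  have hZc := Finset.card_le_card hZW
  have hcard : (W \ Z).card = W.card - Z.card := Finset.card_sdiff_of_subset hZW
  rw [hcard, hW] at hle
  have hsmall : ∀ A ⊆ Z, A ≠ Z → R.ClosedIn Z A → A.card ≤ 5 := by
    intro A hA hne hAcl
    have h1 := hmin A hA hne hAcl
    have h2 := hclosed A (hA.trans hZW) (hcl.trans hA hAcl)
    omega
  have hZ : R.ConnOn Z := by
    intro A hA hne hAZ hAcl
    have h1 := hsmall A hA hAZ hAcl
    have h2 := hsmall (Z \ A) Finset.sdiff_subset (fun e => by
      obtain ⟨a, ha⟩ := hne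
      have := hA ha
      rw [← e] at this
      exact (Finset.mem_sdiff.1 this).2 ha) hAcl.compl
    -- A cut of `Z` would leave three closed parts of at most five vertices, with total degree sum
    -- at most `3 * 20 < 62`.
    have h3 := hAcl.degSum_eq hA
    have h4 := (degSum_le (G := R) A).trans (Nat.mul_le_mul h1 (Nat.sub_le_sub_right h1 1))
    have h5 := (degSum_le (G := R) (Z \ A)).trans (Nat.mul_le_mul h2 (Nat.sub_le_sub_right h2 1))
    have h6 : 14 - Z.card ≤ 5 := by omega
    have h7 := hle.trans (Nat.mul_le_mul h6 (Nat.sub_le_sub_right h6 1))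
    omega
  have hlow : 4 * Z.card + 6 ≤ R.degSum Z := by
    generalize hs : Z.card = s at *
    have : s ≤ 14 := by omega
    interval_cases s <;> omega
  obtain ⟨H, hHZ, hH3, hcov⟩ := hR.exists_cover hZ (by omega) hlow
  have hup := degSum_le_of_cover hHZ hH3 hcov
  -- For 10 or 11 vertices, the cover bound plus a complete graph outside `Z` gives a degree sum of
  -- only 60.
  have hs : Z.card = 9 ∨ 12 ≤ Z.card := by
    generalize hs : Z.card = s at *
    have : s ≤ 14 := by omega
    interval_cases s <;> omega
  have hQcard : (Z \ H).card = Z.card - 3 := by rw [Finset.card_sdiff_of_subset hHZ, hH3]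
  have hQQ : ∀ u ∈ Z \ H, ∀ v ∈ Z \ H, u ≠ v → B.Adj u v ∨ G.Adj u v := by
    intro u hu v hv huv
    rw [Finset.mem_sdiff] at hu hv
    refine (h u (hZW hu.1) v (hZW hv.1) huv).resolve_left fun huv => ?_
    rcases hcov u hu.1 v hv.1 huv with h | h
    exacts [hu.2 h, hv.2 h]
  have hout : ∀ u ∈ Z, ∀ v ∈ W \ Z, B.Adj u v ∨ G.Adj u v := fun u hu v hv => by
    rw [Finset.mem_sdiff] at hv
    exact (h u (hZW hu) v hv.1 fun e => hv.2 (e ▸ hu)).resolve_left (hcl u hu v hv.1 hv.2)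
  rcases hs with hs | hs
  · exact hB.not_nine_five hG (F := W \ Z) (W := Z) (Q := Z \ H) (by omega) (by omega) hs
      Finset.sdiff_subset Finset.sdiff_disjoint (fun f hf w hw => hout w hw f hf) hQQ
  -- At most one edge lies outside `Z`; it is the only one avoiding `H` that may need colour `R`.
  · obtain ⟨x, y, hxy⟩ : ∃ x y, W \ Z ⊆ {x, y} := by
      obtain ⟨T, hT, hTc⟩ := Finset.exists_subsuperset_card_eq (s := W \ Z) (t := W) (n := 2)
        Finset.sdiff_subset (by omega) (by omega)
      obtain ⟨x, y, -, rfl⟩ := Finset.card_eq_two.1 hTc.2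
      exact ⟨x, y, hT⟩
    refine hB.not_eleven hG (W := W \ H) (x := x) (y := y)
      (by rw [Finset.card_sdiff_of_subset (hHZ.trans hZW)]; omega) fun u hu v hv huv => ?_
    rw [Finset.mem_sdiff] at hu hv
    by_cases huZ : u ∈ Z
    · by_cases hvZ : v ∈ Z
      · have := hQQ u (Finset.mem_sdiff.2 ⟨huZ, hu.2⟩) v (Finset.mem_sdiff.2 ⟨hvZ, hv.2⟩) huv
        tauto
      · have := hout u huZ v (Finset.mem_sdiff.2 ⟨hv.1, hvZ⟩)
        tauto
    · by_cases hvZ : v ∈ Z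
      · have := hout v hvZ u (Finset.mem_sdiff.2 ⟨hu.1, huZ⟩)
        rw [B.adj_comm, G.adj_comm] at this
        tauto
      · have hu' := hxy (Finset.mem_sdiff.2 ⟨hu.1, huZ⟩)
        have hv' := hxy (Finset.mem_sdiff.2 ⟨hv.1, hvZ⟩)
        simp only [Finset.mem_insert, Finset.mem_singleton] at hu' hv'
        rcases hu' with rfl | rfl <;> rcases hv' with rfl | rfl <;> tauto

/-- Three `P_8`-free graphs do not cover `K_14`. -/
theorem P8Free.not_fourteen (hR : R.P8Free) (hB : B.P8Free) (hG : G.P8Free)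
    {W : Finset V} (hW : W.card = 14)
    (h : ∀ u ∈ W, ∀ v ∈ W, u ≠ v → R.Adj u v ∨ B.Adj u v ∨ G.Adj u v) : False := by
  have h1 := card_mul_le_degSum_add h
  rw [hW] at h1
  by_cases hr : 61 ≤ R.degSum W
  · exact hR.not_fourteen_of_degSum hB hG hW h hr
  by_cases hb : 61 ≤ B.degSum W
  · exact hB.not_fourteen_of_degSum hR hG hW
      (fun u hu v hv huv => by have := h u hu v hv huv; tauto) hb
  · exact hG.not_fourteen_of_degSum hR hB hW
      (fun u hu v hv huv => by have := h u hu v hv huv; tauto) (by omega)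

/-! ### Graph containment and the colouring of `K_13`. -/

lemma P8Free.of_not_isContained (h : ¬ (pathGraph 8).IsContained G) : G.P8Free := by
  intro l hl hn hc
  apply h
  refine ⟨⟨⟨fun i => l.get (i.cast hl.symm), ?_⟩, ?_⟩⟩
  · have key : ∀ a b : Fin 8, a.val + 1 = b.val →
        G.Adj (l.get (a.cast hl.symm)) (l.get (b.cast hl.symm)) := by
      intro a b hab
      have := List.isChain_iff_getElem.1 hc a.val (by omega)
      simp only [List.get_eq_getElem, Fin.val_cast]
      simpa only [← hab] using this
    intro a b hab
    rw [pathGraph_adj] at hab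
    rcases hab with hab | hab
    · exact key a b hab
    · exact (key b a hab).symm
  · intro a b hab
    have := (List.nodup_iff_injective_get.1 hn) hab
    simpa [Fin.ext_iff] using this

/-- A copy of `P_8` needs a component with eight vertices. -/
lemma not_isContained_of_invariant {n : ℕ} {H : SimpleGraph (Fin n)} (f : Fin n → Bool)
    (hf : ∀ u v, H.Adj u v → f u = f v) (hc : ∀ b, (Finset.univ.filter fun u => f u = b).card ≤ 7) :
    ¬ (pathGraph 8).IsContained H := by
  rintro ⟨φ⟩
  have hφ : ∀ k (hk : k < 8), f (φ ⟨k, hk⟩) = f (φ 0) := by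
    intro k
    induction k with
    | zero => intro _; rfl
    | succ k ih =>
      intro hk
      rw [← ih (by omega)]
      refine (hf _ _ (φ.toHom.map_adj ?_)).symm
      rw [pathGraph_adj]
      exact .inl rfl
  have h8 : (Finset.univ : Finset (Fin 8)).card ≤
      (Finset.univ.filter fun u => f u = f (φ 0)).card :=
    Finset.card_le_card_of_injOn φ (fun i _ => by simpa using hφ i.val i.isLt)
      (φ.injective.injOn)
  have := hc (f (φ 0))
  simp at h8
  omega

end SimpleGraph

/-- The class of a vertex in the partition of at most thirteen vertices into parts of sizes
`4, 3, 3, 3`, as a pair of bits. -/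
def partBits (v : ℕ) : Bool × Bool := (decide (7 ≤ v), decide (4 ≤ v ∧ v < 7 ∨ 10 ≤ v))

/-- The colour of an edge between two classes. -/
def partColour (p q : Bool × Bool) : Fin 3 :=
  if p.1 = q.1 then 0 else if p.2 = q.2 then 1 else 2

/-- Each colour preserves one bit function of the class: the first bit, the second bit, or their
sum. Each value of such a function is taken on two classes, hence on at most `4 + 3 = 7` vertices.
-/
lemma not_ramseyArrows {m : ℕ} (hm : m ≤ 13) :
    ¬ RamseyArrows m (fun _ : Fin 3 => SimpleGraph.pathGraph 8) := by
  intro h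
  obtain ⟨i, hi⟩ := h (SimpleGraph.EdgeLabeling.mk
    (fun u v _ => partColour (partBits u.val) (partBits v.val)) (by
      intro u v _
      simp only [partColour, eq_comm]))
  revert hi
  have hcount : ∀ (g : ℕ → Bool), (∀ b, ((Finset.range 13).filter fun v => g v = b).card ≤ 7) →
      ∀ b, (Finset.univ.filter fun u : Fin m => g u.val = b).card ≤ 7 := by
    intro g hg b
    refine le_trans ?_ (hg b)
    refine Finset.card_le_card_of_injOn Fin.val (fun u hu => ?_) Fin.val_injective.injOn
    have := u.isLt
    simp only [Finset.coe_filter, Finset.mem_univ, true_and, Set.mem_ofPred_eq, Finset.mem_range]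
      at hu ⊢
    exact ⟨by omega, hu⟩
  have hadj : ∀ (u v : Fin m), (SimpleGraph.EdgeLabeling.labelGraph (SimpleGraph.EdgeLabeling.mk
    (G := (⊤ : SimpleGraph (Fin m))) (fun u v _ => partColour (partBits u.val) (partBits v.val)) (by
      intro u v _
      simp only [partColour, eq_comm])) i).Adj u v →
      partColour (partBits u.val) (partBits v.val) = i := by
    intro u v huv
    rw [SimpleGraph.EdgeLabeling.labelGraph_adj] at huv
    obtain ⟨H, hH⟩ := huv
    exact hH
  have hcol : ∀ p q : Bool × Bool, (partColour p q = 0 → p.1 = q.1) ∧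
      (partColour p q = 1 → p.2 = q.2) ∧ (partColour p q = 2 → xor p.1 p.2 = xor q.1 q.2) := by
    decide
  fin_cases i
  · exact SimpleGraph.not_isContained_of_invariant (fun u => (partBits u.val).1)
      (fun u v huv => (hcol _ _).1 (hadj u v huv)) (hcount (fun v => (partBits v).1) (by decide))
  · exact SimpleGraph.not_isContained_of_invariant (fun u => (partBits u.val).2)
      (fun u v huv => (hcol _ _).2.1 (hadj u v huv)) (hcount (fun v => (partBits v).2) (by decide))
  · exact SimpleGraph.not_isContained_of_invariant
      (fun u => xor (partBits u.val).1 (partBits u.val).2)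
      (fun u v huv => (hcol _ _).2.2 (hadj u v huv))
      (hcount (fun v => xor (partBits v).1 (partBits v).2) (by decide))

theorem theorem10 : IsDiagonalRamseyNumber 3 (SimpleGraph.pathGraph 8) 14 := by
  refine ⟨fun C => ?_, fun m hm => ?_⟩
  · by_contra hC
    have hP : ∀ i, (C.labelGraph i).P8Free := fun i => .of_not_isContained fun h => hC ⟨i, h⟩
    refine (hP 0).not_fourteen (hP 1) (hP 2) (W := Finset.univ) (by simp) fun u _ v _ huv => ?_
    simp only [SimpleGraph.TopEdgeLabeling.labelGraph_adj, huv, ne_eq, not_false_eq_true,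
      exists_true_left]
    generalize SimpleGraph.EdgeLabeling.get C u v _ = c
    fin_cases c <;> simp
  · by_contra! h
    exact not_ramseyArrows (by omega) hm
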